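/- Let $(W,S)$ be a Coxeter system with Coxeter matrix $(m_{st})$, and let $A$ be the associated Artin group, with generators $a_s$ ($s\in S$) and relations $a_sa_ta_s\cdots=a_ta_sa_t\cdots$ ($m_{st}$ factors on each side) for all $s\ne t$ with $m_{st}\neq\infty$. For $T\subseteq S$ let $W_T$ be the subgroup of $W$ generated by $T$; call $T$ spherical if $W_T$ is finite. The diagram of $(W,S)$ is the graph on $S$ in which distinct $s,t$ are joined by an edge if and only if $m_{st}>2$ (including $m_{st}=\infty$). The decomposition of a subset $T\subseteq S$ is the set of vertex sets of the connected components of the full subgraph of the diagram spanned by $T$. Let $S_\oslash$ be the set of nonempty spherical subsets $T\subseteq S$ whose spanned subgraph is connected, ordered by inclusion. Define nested subsets of $S_\oslash$ inductively: $\emptyset$ is nested, and a subset $\alpha\subseteq S_\oslash$ is nested if its support $sp(\alpha)=\bigcup_{T\in\alpha}T$ is spherical, the maximal elements of $\alpha$ form the decomposition of $sp(\alpha)$, and for each maximal element $T$ of $\alpha$ the set $\{T'\in\alpha\mid T'\subsetneq T\}$ is nested. A $d$-simplex $\alpha$ of $L_\oslash$ ($d\ge 0$) is a nested subset of $S_\oslash$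 with $d+1$ elements; these elements form its vertex set $\operatorname{Vert}\alpha$. For $w\in W$ put $a_w=a_{s_1}\cdots a_{s_l}$, where $s_1\cdots s_l$ is a reduced expression for $w$ (the element $a_w\in A$ does not depend on the choice). For $T\in S_\oslash$ let $w_T$ be the element of longest length in $W_T$ and put $\Delta_T=a_{w_T}$. Let $\delta_T=\Delta_T$ if $w_Ttw_T^{-1}=t$ for all $t\in T$, and $\delta_T=\Delta_T^2$ otherwise. For a simplex $\alpha$ of $L_\oslash$, the standard abelian subgroup $H_\alpha\le A$ is the subgroup generated by $\{\delta_T\mid T\in\operatorname{Vert}\alpha\}$. Then for each $d$-simplex $\alpha$ of $L_\oslash$, the assignment $T\mapsto\delta_T$ on basis elements extends to a group isomorphism $\mathbb Z^{\operatorname{Vert}\alpha}\to H_\alpha$. Hence $H_\alpha$ is free abelian of rank $d+1$. -/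

import Mathlib

/-! ### Artin groups -/

namespace CoxeterMatrix

variable {B : Type*} (M : CoxeterMatrix B)

/-- The word `⋯ i i' i i'` with `M i i'` letters (ending in `i'`), read in the free group. -/
def braidProd (i i' : B) : FreeGroup B :=
  ((CoxeterSystem.braidWord M i i').map FreeGroup.of).prod

/-- The Artin relators: for each pair `i, i'` with `M i i' ≠ ∞` (Mathlib encodes `∞` as `0`), the
two alternating words in `i, i'` with `M i i'` letters are identified. -/
def artinRelators : Set (FreeGroup B) :=
  {r | ∃ i i' : B, M i i' ≠ 0 ∧ r = M.braidProd i i' * (M.braidProd i' i)⁻¹}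

/-- The Artin group associated to a Coxeter matrix. -/
abbrev ArtinGroup : Type _ := PresentedGroup M.artinRelators

/-- The standard generator `a_i` of the Artin group. -/
def artinGen (i : B) : M.ArtinGroup := PresentedGroup.of i

/-- The Coxeter diagram without its labels: there is an edge between `i ≠ i'` whenever
`M i i' > 2`. As off-diagonal entries are never `1` and `0` stands for `∞`, this means
`M i i' ≠ 2`. -/
def diagram : SimpleGraph B where
  Adj i i' := i ≠ i' ∧ M i i' ≠ 2
  symm := ⟨fun i i' h => ⟨h.1.symm, by rw [M.symmetric i' i]; exact h.2⟩⟩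
  loopless := ⟨fun _ h => h.1 rfl⟩

/-- The decomposition of `X` into irreducibles: the set of vertex sets of the connected components
of the full subgraph of the diagram spanned by `X`. -/
def decomposition (X : Set B) : Set (Set B) :=
  {C | ∃ c : (M.diagram.induce X).ConnectedComponent, C = Subtype.val '' c.supp}

end CoxeterMatrix

namespace CoxeterSystem

variable {B W : Type*} [Group W] {M : CoxeterMatrix B} (cs : CoxeterSystem M W)

/-- The special subgroup `W_T` generated by `T`. -/
def special (T : Set B) : Subgroup W := Subgroup.closure (cs.simple '' T)

/-- `T` is spherical if `W_T` is finite. -/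
def IsSpherical (T : Set B) : Prop := Finite (cs.special T)

/-- `S_⊘`, the set of nonempty irreducible spherical subsets of `S`, partially ordered by inclusion.
(`SimpleGraph.Connected` includes non-emptiness.) -/
abbrev IrrSpherical : Type _ :=
  {T : Set B // cs.IsSpherical T ∧ (M.diagram.induce T).Connected}

/-- The support of a set of irreducible spherical subsets: its union. -/
def support (α : Set cs.IrrSpherical) : Set B := ⋃ T ∈ α, T.1

/-- Nested subsets of `S_⊘`: the empty set is nested; a set `α` is nested if its support is
spherical, its maximal elements form the decomposition of its support into irreducibles, and for
each maximal element `T` of `α` the set of elements of `α` strictly smaller than `T` is nested. -/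
inductive IsNested : Set cs.IrrSpherical → Prop
  | empty : IsNested ∅
  | step (α : Set cs.IrrSpherical)
      (spherical : cs.IsSpherical (cs.support α))
      (maximal : Subtype.val '' {T | Maximal (· ∈ α) T} = M.decomposition (cs.support α))
      (below : ∀ T, Maximal (· ∈ α) T → IsNested {T' | T' ∈ α ∧ T' < T}) : IsNested α

/-- `α` is (the vertex set of) a `d`-simplex of the complex `L_⊘`, whose simplices are the nonempty
nested subsets of `S_⊘`. -/
def IsSimplex (d : ℕ) (α : Finset cs.IrrSpherical) : Prop :=
  cs.IsNested (α : Set cs.IrrSpherical) ∧ α.card = d + 1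

/-- The lift `a_w` of `w` to the Artin group: `a_{s_1} ⋯ a_{s_l}` for a reduced expression
`s_1 ⋯ s_l` of `w` (the element does not depend on the reduced expression). -/
noncomputable def artinLift (w : W) : M.ArtinGroup :=
  ((cs.exists_isReduced w).choose.map M.artinGen).prod

theorem exists_longest {T : Set B} (hT : cs.IsSpherical T) :
    ∃ w ∈ cs.special T, ∀ v ∈ cs.special T, cs.length v ≤ cs.length w :=
  Set.exists_max_image (cs.special T : Set W) cs.length
    hT ⟨1, (cs.special T).one_mem⟩

/-- The (unique) element `w_T` of longest length in `W_T`. -/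
noncomputable def longest (T : cs.IrrSpherical) : W :=
  (cs.exists_longest T.2.1).choose

/-- `Δ_T = a_{w_T}`. -/
noncomputable def artinDelta (T : cs.IrrSpherical) : M.ArtinGroup :=
  cs.artinLift (cs.longest T)

open Classical in
/-- `δ_T`, which is `Δ_T` if conjugation by `w_T` induces the identity permutation of `T`, and
`Δ_T ^ 2` otherwise. -/
noncomputable def artinCentral (T : cs.IrrSpherical) : M.ArtinGroup :=
  if ∀ t ∈ T.1, cs.longest T * cs.simple t * (cs.longest T)⁻¹ = cs.simple t then
    cs.artinDelta T
  else cs.artinDelta T ^ 2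

/-- The standard abelian subgroup `H_α` of the Artin group, generated by the `δ_T` with `T ∈ α`. -/
def standardAbelian (α : Finset cs.IrrSpherical) : Subgroup M.ArtinGroup :=
  Subgroup.closure (cs.artinCentral '' (α : Set cs.IrrSpherical))

end CoxeterSystem

namespace CoxeterSystem

variable {B W : Type*} [Group W] {M : CoxeterMatrix B} (cs : CoxeterSystem M W)

/-! ### The inversion parity and the exchange condition -/

/-! Two members of a nested set are comparable or orthogonal. In the first case the larger `δ`
commutes with every generator of its own set; in the second all generators involved commute. So the
`δ_T` commute, and since they generate `H_α`, only their independence over `ℤ` is at stake.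

In a nontrivial relation take `T` maximal among the sets with nonzero coefficient. The members of
`α` strictly below `T` cannot cover it: they would form a nested set with connected support `T`, so
`T` would be one of them. Hence some letter `i` of `T` lies in no other set of the relation. After a
sign change the coefficient of `T` is positive; moving negative terms across gives an equality of
positive elements, one involving `a_i`, the other written without it.

This is excluded by `mul_artinGen_mul_notMem_artinPositive`. Counting letters is not enough, because
`a_i` and `a_j` are conjugate when `M i j` is odd. Instead the Artin group acts on functions on `W`
by Hecke operators at `q = 2`, whose coefficients are nonnegative. With `X` the set of letters other
than `i`, generators from `X` keep the indicator of `1` supported on `W_X`, whereas `a_i` creates a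
positive value outside `W_X`, which no later positive operator can remove.

The Coxeter-theoretic input is the exchange condition (from inversion parities), the exact order of
`s_i s_j` (from the geometric representation) and Matsumoto's theorem, which makes `a_w` independent
of the reduced word. -/

theorem reverse_alternatingWord_two_mul (i j : B) (p : ℕ) :
    (alternatingWord i j (2 * p)).reverse = alternatingWord j i (2 * p) := by
  apply List.ext_getElem
  · simp
  · intro k h1 h2
    simp only [List.length_reverse, length_alternatingWord] at h1 h2
    rw [List.getElem_reverse]
    simp only [length_alternatingWord]
    rw [getElem_alternatingWord _ _ _ _ (by lia), getElem_alternatingWord _ _ _ _ (by lia)]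
    by_cases hk : Even k
    · rw [if_neg, if_pos]
      · grind
      · grind
    · rw [if_pos, if_neg]
      · grind
      · grind

theorem leftInvSeq_alternatingWord_eq_map (i j : B) (p : ℕ) :
    cs.leftInvSeq (alternatingWord i j (2 * p)) =
      (List.range (2 * p)).map fun k => cs.simple i * (cs.simple j * cs.simple i) ^ k := by
  apply List.ext_getElem
  · simp
  · intro k h1 h2
    simp only [length_leftInvSeq, length_alternatingWord] at h1
    rw [cs.getElem_leftInvSeq_alternatingWord i j p k h1, prod_alternatingWord_eq_mul_pow]
    have h3 : ¬ Even (2 * k + 1) := by simp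
    have h4 : (2 * k + 1) / 2 = k := by lia
    simp [h3, h4]

open Classical in
/-- The involution `(t, ε) ↦ (s t s, ε + [t = s])` of `W × ZMod 2`. -/
noncomputable def inversionPerm (i : B) : Equiv.Perm (W × ZMod 2) where
  toFun p := (cs.simple i * p.1 * cs.simple i, p.2 + if p.1 = cs.simple i then 1 else 0)
  invFun p := (cs.simple i * p.1 * cs.simple i, p.2 + if p.1 = cs.simple i then 1 else 0)
  left_inv := by
    rintro ⟨t, ε⟩
    have h : cs.simple i * t * cs.simple i = cs.simple i ↔ t = cs.simple i := by
      rw [mul_assoc, mul_eq_left, ← eq_inv_iff_mul_eq_one, inv_simple]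
    have h2 : (1 : ZMod 2) + 1 = 0 := by decide
    ext <;> simp only [h]
    · simp [mul_assoc]
    · split_ifs <;> simp [add_assoc, h2]
  right_inv := by
    rintro ⟨t, ε⟩
    have h : cs.simple i * t * cs.simple i = cs.simple i ↔ t = cs.simple i := by
      rw [mul_assoc, mul_eq_left, ← eq_inv_iff_mul_eq_one, inv_simple]
    have h2 : (1 : ZMod 2) + 1 = 0 := by decide
    ext <;> simp only [h]
    · simp [mul_assoc]
    · split_ifs <;> simp [add_assoc, h2]

open Classical in
theorem prod_map_inversionPerm (ω : List B) (t : W) (ε : ZMod 2) :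
    (ω.map cs.inversionPerm).prod (t, ε) =
      (cs.wordProd ω * t * (cs.wordProd ω)⁻¹, ε + (cs.rightInvSeq ω).count t) := by
  induction ω with
  | nil => simp
  | cons i ω ih =>
    rw [List.map_cons, List.prod_cons, Equiv.Perm.mul_apply, ih]
    have h : cs.wordProd ω * t * (cs.wordProd ω)⁻¹ = cs.simple i ↔
        (cs.wordProd ω)⁻¹ * cs.simple i * cs.wordProd ω = t := by
      constructor
      · rintro h; rw [← h]; group
      · rintro rfl; group
    ext
    · simp [inversionPerm, wordProd_cons, mul_assoc]
    · simp only [inversionPerm, Equiv.coe_fn_mk, h, rightInvSeq, List.count_cons, beq_iff_eq]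
      push_cast
      rw [add_assoc]

open Classical in
-- The inversion sequence of the alternating word of length `2 * M i j` is periodic with period `M i
-- j`, so every reflection occurs in it an even number of times.
theorem isLiftable_inversionPerm : M.IsLiftable cs.inversionPerm := by
  intro i j
  have key : ∀ p : ℕ, (cs.inversionPerm i * cs.inversionPerm j) ^ p =
      ((alternatingWord i j (2 * p)).map cs.inversionPerm).prod := by
    intro p
    induction p with
    | zero => simp [alternatingWord]
    | succ p ih =>
      rw [pow_succ, ih, show 2 * (p + 1) = 2 * p + 1 + 1 by ring, alternatingWord_succ,
        alternatingWord_succ]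
      simp
  rw [key]
  ext1 ⟨t, ε⟩
  rw [prod_map_inversionPerm, ← reverse_alternatingWord_two_mul, rightInvSeq_reverse,
    List.count_reverse, reverse_alternatingWord_two_mul, leftInvSeq_alternatingWord_eq_map]
  have h1 : cs.wordProd (alternatingWord i j (2 * M i j)) = 1 := by
    rw [prod_alternatingWord_eq_mul_pow]; simp
  rw [h1, two_mul, List.range_add, List.map_append, List.map_map]
  have h2 : ((fun k => cs.simple j * (cs.simple i * cs.simple j) ^ k) ∘ fun x => M i j + x) =
      fun k => cs.simple j * (cs.simple i * cs.simple j) ^ k := by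
    funext k
    simp [pow_add]
  rw [h2, List.count_append]
  have h3 : ∀ a : ZMod 2, a + a = 0 := by decide
  simp [h3]

/-- The action of `W` on `W × ZMod 2` that records inversions modulo two. -/
noncomputable def inversionAction : W →* Equiv.Perm (W × ZMod 2) :=
  cs.lift ⟨cs.inversionPerm, cs.isLiftable_inversionPerm⟩

/-- The parity of the number of occurrences of `t` in the right inversion sequence of any
word for `w`. -/
noncomputable def inversionParity (w t : W) : ZMod 2 := (cs.inversionAction w (t, 0)).2

open Classical in
theorem inversionAction_wordProd (ω : List B) (t : W) (ε : ZMod 2) :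
    cs.inversionAction (cs.wordProd ω) (t, ε) =
      (cs.wordProd ω * t * (cs.wordProd ω)⁻¹, ε + (cs.rightInvSeq ω).count t) := by
  rw [← prod_map_inversionPerm, wordProd, map_list_prod, List.map_map]
  congr 4
  funext i
  simp [inversionAction]

open Classical in
theorem inversionParity_wordProd (ω : List B) (t : W) :
    cs.inversionParity (cs.wordProd ω) t = (cs.rightInvSeq ω).count t := by
  simp [inversionParity, inversionAction_wordProd]

theorem inversionAction_apply (w t : W) (ε : ZMod 2) :
    cs.inversionAction w (t, ε) = (w * t * w⁻¹, ε + cs.inversionParity w t) := by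
  classical
  obtain ⟨ω, rfl⟩ := cs.wordProd_surjective w
  rw [inversionAction_wordProd, inversionParity_wordProd]

theorem inversionParity_mul (x y t : W) :
    cs.inversionParity (x * y) t =
      cs.inversionParity y t + cs.inversionParity x (y * t * y⁻¹) := by
  have h := cs.inversionAction_apply (x * y) t 0
  rw [map_mul, Equiv.Perm.mul_apply, inversionAction_apply, inversionAction_apply] at h
  simpa using (congrArg Prod.snd h).symm

@[simp]
theorem inversionParity_one (t : W) : cs.inversionParity 1 t = 0 := by
  simp [inversionParity]

open Classical in
theorem inversionParity_simple (i : B) (t : W) :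
    cs.inversionParity (cs.simple i) t = if t = cs.simple i then 1 else 0 := by
  rw [← wordProd_singleton, inversionParity_wordProd]
  simp only [rightInvSeq_singleton, List.count_singleton, wordProd_singleton, beq_iff_eq,
    eq_comm (a := t)]
  split_ifs <;> simp

/-- For `r = u s u⁻¹`, the cocycle rule makes the contributions of `u` and `u⁻¹` cancel, and the
middle `s` contributes `1`. -/
theorem IsReflection.inversionParity_self {cs : CoxeterSystem M W} {r : W}
    (hr : cs.IsReflection r) : cs.inversionParity r r = 1 := by
  obtain ⟨u, i, rfl⟩ := hr
  rw [inversionParity_mul, inversionParity_mul]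
  have h1 := cs.inversionParity_mul u u⁻¹ (u * cs.simple i * u⁻¹)
  simp only [mul_inv_cancel, inversionParity_one] at h1
  have e1 : u⁻¹ * (u * cs.simple i * u⁻¹) * u⁻¹⁻¹ = cs.simple i := by group
  rw [e1] at h1 ⊢
  simp only [inv_simple, simple_mul_simple_self, one_mul, inversionParity_simple, if_true]
  linear_combination -h1

theorem IsReflection.length_mul_lt_of_inversionParity_eq_one {cs : CoxeterSystem M W} {r : W}
    {w : W} (h : cs.inversionParity w r = 1) : cs.length (w * r) < cs.length w := by
  classical
  obtain ⟨ω, hω, rfl⟩ := cs.exists_isReduced w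
  rw [inversionParity_wordProd] at h
  have hmem : r ∈ cs.rightInvSeq ω := by
    by_contra hn
    rw [List.count_eq_zero_of_not_mem hn] at h
    simp at h
  exact (cs.isRightInversion_of_mem_rightInvSeq hω hmem).2

theorem inversionParity_eq_zero_or_one (w t : W) :
    cs.inversionParity w t = 0 ∨ cs.inversionParity w t = 1 := by
  generalize cs.inversionParity w t = a
  revert a; decide

/-- The strong exchange condition, in terms of inversion parities. -/
theorem IsReflection.inversionParity_eq_one_iff {cs : CoxeterSystem M W} {r : W}
    (hr : cs.IsReflection r) (w : W) :
    cs.inversionParity w r = 1 ↔ cs.length (w * r) < cs.length w := by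
  refine ⟨length_mul_lt_of_inversionParity_eq_one, fun h => ?_⟩
  refine (cs.inversionParity_eq_zero_or_one w r).resolve_left fun h0 => ?_
  -- Multiplying by `r` flips the parity, so parity `0` at `w` would make `w = (w * r) * r` shorter
  -- than `w * r`.
  have h1 : cs.inversionParity (w * r) r = 1 := by
    rw [inversionParity_mul, hr.inversionParity_self]
    simp [h0]
  have h2 := length_mul_lt_of_inversionParity_eq_one h1
  rw [mul_assoc, hr.mul_self, mul_one] at h2
  lia

theorem IsReflection.inversionParity_eq_zero_iff {cs : CoxeterSystem M W} {r : W}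
    (hr : cs.IsReflection r) (w : W) :
    cs.inversionParity w r = 0 ↔ cs.length w < cs.length (w * r) := by
  have h1 := hr.inversionParity_eq_one_iff w
  have h2 := hr.length_mul_left_ne w
  rcases cs.inversionParity_eq_zero_or_one w r with h | h
  · simp only [h, true_iff]
    simp only [h, zero_ne_one, false_iff] at h1
    lia
  · simp only [h, true_iff] at h1
    simp only [h, one_ne_zero, false_iff]
    lia

/-- The exchange condition. -/
theorem exists_eraseIdx_of_isRightDescent {ω : List B} {i : B}
    (h : cs.IsRightDescent (cs.wordProd ω) i) :
    ∃ j < ω.length, cs.wordProd ω * cs.simple i = cs.wordProd (ω.eraseIdx j) := by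
  classical
  have h1 := ((cs.isReflection_simple i).inversionParity_eq_one_iff (cs.wordProd ω)).2 h
  rw [inversionParity_wordProd] at h1
  have hmem : cs.simple i ∈ cs.rightInvSeq ω := by
    by_contra hn
    rw [List.count_eq_zero_of_not_mem hn] at h1
    simp at h1
  obtain ⟨j, hj, hji⟩ := List.mem_iff_getElem.mp hmem
  refine ⟨j, by simpa using hj, ?_⟩
  rw [← wordProd_mul_getD_rightInvSeq, List.getD_eq_getElem _ 1 hj, hji]

/-- The exchange condition, on the left. -/
theorem exists_eraseIdx_of_isLeftDescent {ω : List B} {i : B}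
    (h : cs.IsLeftDescent (cs.wordProd ω) i) :
    ∃ j < ω.length, cs.simple i * cs.wordProd ω = cs.wordProd (ω.eraseIdx j) := by
  rw [← isRightDescent_inv_iff, ← wordProd_reverse] at h
  obtain ⟨j, hj, e⟩ := cs.exists_eraseIdx_of_isRightDescent h
  rw [List.length_reverse] at hj
  refine ⟨ω.length - 1 - j, by lia, ?_⟩
  rw [← inv_inj, ← wordProd_reverse (ω := ω.eraseIdx _), mul_inv_rev, ← wordProd_reverse,
    inv_simple, e]
  congr 1
  rw [List.eraseIdx_eq_take_drop_succ, List.eraseIdx_eq_take_drop_succ, List.reverse_append,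
    List.take_reverse, List.drop_reverse]
  congr 3 <;> lia

/-- A reflection occurring exactly once has parity `1`, hence occurs in the inversion sequence of
every word for the same element; no such word can be shorter. -/
theorem isReduced_of_nodup_rightInvSeq {ω : List B} (h : (cs.rightInvSeq ω).Nodup) :
    cs.IsReduced ω := by
  classical
  obtain ⟨ω', hω', e⟩ := cs.exists_isReduced (cs.wordProd ω)
  have hsub : (cs.rightInvSeq ω).toFinset ⊆ (cs.rightInvSeq ω').toFinset := by
    intro t ht
    rw [List.mem_toFinset] at ht ⊢
    have h1 := cs.inversionParity_wordProd ω t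
    rw [e, inversionParity_wordProd, List.count_eq_one_of_mem h ht] at h1
    by_contra hn
    rw [List.count_eq_zero_of_not_mem hn] at h1
    simp at h1
  have h2 := Finset.card_le_card hsub
  rw [List.toFinset_card_of_nodup h, List.toFinset_card_of_nodup hω'.nodup_rightInvSeq,
    length_rightInvSeq, length_rightInvSeq, ← hω'.eq, ← e] at h2
  exact le_antisymm (cs.length_wordProd_le ω) h2

/-- If exactly one of `ℓ(w t) < ℓ(w)` and `ℓ(s w t) < ℓ(s w)` holds, then `s w = w t`. -/
theorem simple_mul_eq_mul_simple_of_isRightDescent {w : W} {i j : B}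
    (h : ¬(cs.IsRightDescent (cs.simple i * w) j ↔ cs.IsRightDescent w j)) :
    cs.simple i * w = w * cs.simple j := by
  have hj := cs.isReflection_simple j
  unfold IsRightDescent at h
  -- By the cocycle rule the two parities differ exactly when `w s_j w⁻¹ = s_i`.
  rw [← hj.inversionParity_eq_one_iff, ← hj.inversionParity_eq_one_iff, inversionParity_mul,
    inversionParity_simple] at h
  split_ifs at h with h1
  · rw [← h1]; group
  · simp at h

/-! ### Special subgroups -/

theorem wordProd_mem_special {T : Set B} {ω : List B} (h : ∀ i ∈ ω, i ∈ T) :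
    cs.wordProd ω ∈ cs.special T := by
  refine Subgroup.list_prod_mem _ fun x hx => ?_
  obtain ⟨i, hi, rfl⟩ := List.mem_map.1 hx
  exact Subgroup.subset_closure ⟨i, h i hi, rfl⟩

theorem simple_mem_special {T : Set B} {i : B} (h : i ∈ T) : cs.simple i ∈ cs.special T :=
  Subgroup.subset_closure ⟨i, h, rfl⟩

/-- Every element of `W_T` has a reduced word in the letters of `T`. -/
theorem exists_isReduced_of_mem_special {T : Set B} {w : W} (hw : w ∈ cs.special T) :
    ∃ ω : List B, (∀ i ∈ ω, i ∈ T) ∧ cs.IsReduced ω ∧ w = cs.wordProd ω := by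
  have step : ∀ i ∈ T, ∀ y : W,
      (∃ ω : List B, (∀ i ∈ ω, i ∈ T) ∧ cs.IsReduced ω ∧ y = cs.wordProd ω) →
      ∃ ω : List B, (∀ i ∈ ω, i ∈ T) ∧ cs.IsReduced ω ∧ cs.simple i * y = cs.wordProd ω := by
    rintro i hi _ ⟨ω, hT, hr, rfl⟩
    by_cases hd : cs.IsLeftDescent (cs.wordProd ω) i
    · obtain ⟨j, hj, e⟩ := cs.exists_eraseIdx_of_isLeftDescent hd
      refine ⟨ω.eraseIdx j, fun k hk => hT k (List.mem_of_mem_eraseIdx hk), ?_, e⟩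
      rw [isLeftDescent_iff, e, hr.eq] at hd
      have := List.length_eraseIdx_add_one hj
      unfold IsReduced
      lia
    · refine ⟨i :: ω, by simpa [hi] using hT, ?_, by rw [wordProd_cons]⟩
      rw [not_isLeftDescent_iff, hr.eq] at hd
      simpa [IsReduced, wordProd_cons] using hd
  induction hw using Subgroup.closure_induction_left with
  | one => exact ⟨[], by simp, by simp [IsReduced], by simp⟩
  | mul_left x hx y _ ih =>
    obtain ⟨i, hi, rfl⟩ := hx
    exact step i hi y ih
  | inv_mul_cancel x hx y _ ih =>
    obtain ⟨i, hi, rfl⟩ := hx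
    rw [inv_simple]
    exact step i hi y ih

/-- If `s w` lies in `W_T` and is longer than `w`, then `w` lies in `W_T`. -/
theorem mem_special_of_simple_mul_mem {T : Set B} {w : W} {i : B}
    (hw : cs.simple i * w ∈ cs.special T) (hl : ¬ cs.IsLeftDescent w i) : w ∈ cs.special T := by
  obtain ⟨ω, hT, -, e⟩ := cs.exists_isReduced_of_mem_special hw
  have hd : cs.IsLeftDescent (cs.wordProd ω) i := by
    rw [← e, isLeftDescent_iff_not_isLeftDescent_mul, simple_mul_simple_cancel_left]
    exact hl
  obtain ⟨j, -, e'⟩ := cs.exists_eraseIdx_of_isLeftDescent hd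
  rw [← e, simple_mul_simple_cancel_left] at e'
  rw [e']
  exact cs.wordProd_mem_special fun k hk => hT k (List.mem_of_mem_eraseIdx hk)

/-! ### Longest elements -/

/-- If `u` has maximal length in `W_T`, then `ℓ(u v⁻¹) = ℓ(u) - ℓ(v)` for all `v` in `W_T`. -/
theorem length_mul_inv_add_length {T : Set B} {u : W} (hu : u ∈ cs.special T)
    (hmax : ∀ v ∈ cs.special T, cs.length v ≤ cs.length u) {v : W} (hv : v ∈ cs.special T) :
    cs.length (u * v⁻¹) + cs.length v = cs.length u := by
  obtain ⟨ω, hT, hr, rfl⟩ := cs.exists_isReduced_of_mem_special hv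
  clear hv
  induction ω with
  | nil => simp
  | cons i ω ih =>
    have hr' : cs.IsReduced ω := by simpa using hr.drop 1
    have hT' : ∀ k ∈ ω, k ∈ T := fun k hk => hT k (List.mem_cons_of_mem _ hk)
    have ih := ih hT' hr'
    set v := cs.wordProd ω with hv
    have hvT : v ∈ cs.special T := cs.wordProd_mem_special hT'
    have hl : cs.length (cs.simple i * v) = cs.length v + 1 := by
      have h1 := hr.eq
      rw [wordProd_cons, ← hv] at h1
      rw [h1, hv, hr'.eq, List.length_cons]
    rw [wordProd_cons, ← hv, hl, mul_inv_rev, inv_simple, ← mul_assoc]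
    rcases cs.length_mul_simple (u * v⁻¹) i with h | h
    swap
    · lia
    -- Otherwise the reflection `v⁻¹ s_i v` has parity `0` in both factors of `u = (u v⁻¹) v`,
    -- although maximality of `u` forces parity `1`.
    exfalso
    have hrefl : cs.IsReflection (v⁻¹ * cs.simple i * v) := ⟨v⁻¹, i, by simp⟩
    have hlt : cs.length (u * (v⁻¹ * cs.simple i * v)) < cs.length u := by
      refine lt_of_le_of_ne (hmax _ ?_) (hrefl.length_mul_left_ne u)
      exact mul_mem hu (mul_mem (mul_mem (inv_mem hvT)
        (cs.simple_mem_special (hT i (by simp)))) hvT)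
    rw [← hrefl.inversionParity_eq_one_iff] at hlt
    have e1 : u = (u * v⁻¹) * v := by group
    rw [e1, inversionParity_mul] at hlt
    have e2 : v * (v⁻¹ * cs.simple i * v) * v⁻¹ = cs.simple i := by group
    have h1 : cs.inversionParity v (v⁻¹ * cs.simple i * v) = 0 := by
      rw [hrefl.inversionParity_eq_zero_iff]
      have e3 : v * (v⁻¹ * cs.simple i * v) = cs.simple i * v := by group
      rw [e3, hl]; lia
    have h2 : cs.inversionParity (u * v⁻¹) (cs.simple i) = 0 := by
      rw [(cs.isReflection_simple i).inversionParity_eq_zero_iff, h]; lia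
    rw [e2, h1, h2] at hlt
    simp at hlt

variable {cs} in
theorem mul_self_eq_one_of_forall_length_le {T : Set B} {u : W} (hu : u ∈ cs.special T)
    (hmax : ∀ v ∈ cs.special T, cs.length v ≤ cs.length u) : u * u = 1 := by
  have h := cs.length_mul_inv_add_length hu hmax (inv_mem hu)
  rw [inv_inv, length_inv] at h
  rw [← cs.length_eq_zero_iff]
  lia

/-- Conjugation by the longest element of `W_T` permutes the simple reflections in `W_T`. -/
theorem exists_conj_simple_eq_simple {T : Set B} {u : W} (hu : u ∈ cs.special T)
    (hmax : ∀ v ∈ cs.special T, cs.length v ≤ cs.length u) {i : B} (hi : i ∈ T) :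
    ∃ j, u * cs.simple i = cs.simple j * u := by
  have hr : u * cs.simple i * u⁻¹ ∈ cs.special T :=
    mul_mem (mul_mem hu (cs.simple_mem_special hi)) (inv_mem hu)
  have h1 := cs.length_mul_inv_add_length hu hmax hr
  have h2 := cs.length_mul_inv_add_length hu hmax (cs.simple_mem_special hi)
  have h3 := mul_self_eq_one_of_forall_length_le hu hmax
  rw [length_simple] at h2
  -- Since `u` is an involution, `h1` and `h2` concern elements of equal length, so the conjugate of
  -- `s_i` has length one.
  have e : u * (u * cs.simple i * u⁻¹)⁻¹ = (u * (cs.simple i)⁻¹)⁻¹ := by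
    rw [eq_inv_iff_mul_eq_one]
    have h4 : u⁻¹ = u := inv_eq_of_mul_eq_one_left h3
    simp only [mul_inv_rev, inv_simple, h4, mul_assoc]
    simp only [← mul_assoc, h3]
    simp
  rw [e, length_inv] at h1
  obtain ⟨j, hj⟩ := cs.length_eq_one_iff.1 (show cs.length (u * cs.simple i * u⁻¹) = 1 by lia)
  exact ⟨j, by rw [← hj]; group⟩

end CoxeterSystem

/-! ### The geometric representation and the order of `s_i s_j` -/

namespace CoxeterMatrix

open Polynomial Polynomial.Chebyshev

variable {B : Type*} (M : CoxeterMatrix B)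

/-- The simple coroot `e_j ↦ -2 cos (π / M i j)` of the geometric representation. As `∞` is encoded
as `0`, the value at `e_j` is `-2` if `M i j = ∞`. -/
noncomputable def geomCoroot (i : B) : Module.Dual ℝ (B →₀ ℝ) :=
  Finsupp.linearCombination ℝ fun j => -2 * Real.cos (Real.pi / M i j)

theorem geomCoroot_single (i j : B) :
    M.geomCoroot i (Finsupp.single j 1) = -2 * Real.cos (Real.pi / M i j) := by
  simp [geomCoroot]

theorem geomCoroot_self (i : B) : M.geomCoroot i (Finsupp.single i 1) = 2 := by
  simp [geomCoroot_single]

/-- The simple reflections of the geometric representation. -/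
noncomputable def geomReflection (i : B) : (B →₀ ℝ) ≃ₗ[ℝ] (B →₀ ℝ) :=
  Module.reflection (M.geomCoroot_self i)

/-- This is the parameter at which the Chebyshev polynomials `S` are evaluated in the formulas for
powers of a product of two reflections. -/
theorem geomCoroot_mul_sub_two (i j : B) :
    M.geomCoroot i (Finsupp.single j 1) * M.geomCoroot j (Finsupp.single i 1) - 2 =
      2 * Real.cos (2 * (Real.pi / M i j)) := by
  rw [geomCoroot_single, geomCoroot_single, M.symmetric j i, Real.cos_two_mul]
  ring

theorem two_le_of_ne {i j : B} (h : i ≠ j) (h0 : M i j ≠ 0) : 2 ≤ M i j := by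
  have := M.off_diagonal i j h
  have h1 : M i j ≠ 1 := this
  lia

theorem sin_two_mul_pi_div_pos {m : ℕ} (hm : 3 ≤ m) : 0 < Real.sin (2 * (Real.pi / m)) := by
  have hm' : (3 : ℝ) ≤ m := by exact_mod_cast hm
  apply Real.sin_pos_of_pos_of_lt_pi
  · positivity
  · rw [← mul_div_assoc, div_lt_iff₀ (by positivity)]
    nlinarith [Real.pi_pos]

/-- With `θ = 2π/m`, `S_a(2 cos θ) sin θ = sin ((a+1)θ)`, and the angles for `a` and `b` add up to
`2π`. For `m = 2` the factor `sin θ` vanishes, so that case is treated apart. -/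
theorem chebyshev_S_add_S_eq_zero {m : ℕ} (hm : 3 ≤ m) {a b : ℤ} (hab : a + b + 2 = m) :
    (S ℝ a).eval (2 * Real.cos (2 * (Real.pi / m))) +
      (S ℝ b).eval (2 * Real.cos (2 * (Real.pi / m))) = 0 := by
  have hs := sin_two_mul_pi_div_pos hm
  have ha := S_two_mul_real_cos (2 * (Real.pi / m)) a
  have hb := S_two_mul_real_cos (2 * (Real.pi / m)) b
  have hm' : (m : ℝ) ≠ 0 := by positivity
  have e : ((b : ℝ) + 1) * (2 * (Real.pi / m)) = 2 * Real.pi - (a + 1) * (2 * (Real.pi / m)) := by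
    have : (a : ℝ) + b + 2 = m := by exact_mod_cast hab
    field_simp
    linear_combination this
  rw [e, Real.sin_two_pi_sub] at hb
  have : ((S ℝ a).eval (2 * Real.cos (2 * (Real.pi / m))) +
      (S ℝ b).eval (2 * Real.cos (2 * (Real.pi / m)))) * Real.sin (2 * (Real.pi / m)) = 0 := by
    linear_combination ha + hb
  exact (mul_eq_zero.1 this).resolve_right hs.ne'

theorem isLiftable_geomReflection : M.IsLiftable M.geomReflection := by
  intro i j
  rcases eq_or_ne i j with rfl | hij
  · rw [M.diagonal, pow_one]
    ext1 v
    rw [LinearEquiv.mul_apply, LinearEquiv.coe_one, id, geomReflection]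
    exact Module.involutive_reflection (M.geomCoroot_self i) v
  rcases eq_or_ne (M i j) 0 with h0 | h0
  · rw [h0, pow_zero]
  have h2 := M.two_le_of_ne hij h0
  rcases h2.eq_or_lt with h2 | h3
  · ext1 z
    have e := M.geomCoroot_single i j
    have e' := M.geomCoroot_single j i
    rw [M.symmetric j i] at e'
    rw [← h2] at e e' ⊢
    simp only [Nat.cast_ofNat, Real.cos_pi_div_two, mul_zero] at e e'
    rw [pow_two]
    simp only [geomReflection, LinearEquiv.mul_apply, Module.reflection_apply, map_sub, map_smul,
      e, e', M.geomCoroot_self, LinearEquiv.coe_one, id]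
    module
  · ext1 z
    have ht := M.geomCoroot_mul_sub_two i j
    have key := Module.reflection_mul_reflection_pow_apply (M.geomCoroot_self i)
      (M.geomCoroot_self j) (M i j) z _ ht.symm
    -- Both coefficients in `key` vanish. The integer divisions force a split on the parity of `M i
    -- j`: in each case either a factor `S` is zero (take `a = b`) or the sum is.
    have c1 : (S ℝ (((M i j : ℕ) - 2 : ℤ) / 2)).eval (2 * Real.cos (2 * (Real.pi / M i j))) *
        ((S ℝ (((M i j : ℕ) - 1 : ℤ) / 2)).eval (2 * Real.cos (2 * (Real.pi / M i j))) +
          (S ℝ (((M i j : ℕ) - 3 : ℤ) / 2)).eval (2 * Real.cos (2 * (Real.pi / M i j)))) = 0 := by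
      rcases Nat.even_or_odd' (M i j) with ⟨k, hk | hk⟩
      · have := chebyshev_S_add_S_eq_zero (m := M i j) h3 (a := ((M i j : ℕ) - 2 : ℤ) / 2)
          (b := ((M i j : ℕ) - 2 : ℤ) / 2) (by lia)
        have : (S ℝ (((M i j : ℕ) - 2 : ℤ) / 2)).eval (2 * Real.cos (2 * (Real.pi / M i j))) = 0 := by
          linarith
        rw [this, zero_mul]
      · rw [chebyshev_S_add_S_eq_zero (m := M i j) h3 (by lia), mul_zero]
    have c2 : (S ℝ (((M i j : ℕ) - 1 : ℤ) / 2)).eval (2 * Real.cos (2 * (Real.pi / M i j))) *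
        ((S ℝ (((M i j : ℕ) : ℤ) / 2)).eval (2 * Real.cos (2 * (Real.pi / M i j))) +
          (S ℝ (((M i j : ℕ) - 2 : ℤ) / 2)).eval (2 * Real.cos (2 * (Real.pi / M i j)))) = 0 := by
      rcases Nat.even_or_odd' (M i j) with ⟨k, hk | hk⟩
      · have := chebyshev_S_add_S_eq_zero (m := M i j) h3 (a := ((M i j : ℕ) - 1 : ℤ) / 2)
          (b := ((M i j : ℕ) - 1 : ℤ) / 2) (by lia)
        have : (S ℝ (((M i j : ℕ) - 1 : ℤ) / 2)).eval (2 * Real.cos (2 * (Real.pi / M i j))) = 0 := by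
          linarith
        rw [this, zero_mul]
      · rw [chebyshev_S_add_S_eq_zero (m := M i j) h3 (by lia), mul_zero]
    rw [c1, c2] at key
    simpa [geomReflection] using key

/-- If a power of the product of two distinct simple reflections of the geometric representation
is trivial, then the exponent is a multiple of `M i j`. -/
theorem dvd_of_geomReflection_pow_eq_one {i j : B} (hij : i ≠ j) {d : ℕ}
    (h : (M.geomReflection i * M.geomReflection j) ^ d = 1) : M i j ∣ d := by
  have ht := M.geomCoroot_mul_sub_two i j
  have key := Module.reflection_mul_reflection_pow_apply_self (M.geomCoroot_self i)
      (M.geomCoroot_self j) d _ ht.symm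
  have e' := M.geomCoroot_single j i
  rw [M.symmetric j i] at e'
  have h1 : ((M.geomReflection i * M.geomReflection j) ^ d) (Finsupp.single i 1) =
      Finsupp.single i 1 := by rw [h]; rfl
  rw [← geomReflection, ← geomReflection, h1, e'] at key
  have k1 := DFunLike.congr_fun key i
  have k2 := DFunLike.congr_fun key j
  simp [hij] at k1 k2
  rcases eq_or_ne (M i j) 0 with h0 | h0
  · simp [h0] at k2
    simp [h0, k2]
  have h2 := M.two_le_of_ne hij h0
  rcases h2.eq_or_lt with h2 | h3
  · rw [← h2] at k1 ⊢
    have e : 2 * (Real.pi / (2 : ℕ)) = Real.pi := by push_cast; ring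
    rw [e, Real.cos_pi] at k1
    simp only [mul_neg, mul_one, S_eval_neg_two] at k1
    rw [← even_iff_two_dvd]
    by_contra hodd
    rw [Nat.not_even_iff_odd] at hodd
    rw [Int.negOnePow_odd _ (by exact_mod_cast hodd),
      Int.negOnePow_even _ (by have := hodd; grind)] at k1
    simp at k1
    linarith
  · have hs := sin_two_mul_pi_div_pos h3
    have hc : Real.cos (Real.pi / M i j) ≠ 0 := by
      intro h
      have : Real.sin (2 * (Real.pi / M i j)) = 0 := by rw [Real.sin_two_mul, h, mul_zero]
      exact hs.ne' this
    have k3 := k2.resolve_right hc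
    rw [k3, add_zero] at k1
    have s1 := S_two_mul_real_cos (2 * (Real.pi / M i j)) d
    have s2 := S_two_mul_real_cos (2 * (Real.pi / M i j)) (d - 1)
    rw [k3, zero_mul] at s2
    rw [← k1, one_mul] at s1
    push_cast at s1 s2
    rw [sub_add_cancel] at s2
    rw [add_mul, one_mul, Real.sin_add, ← s2, zero_mul, zero_add] at s1
    -- The coordinates gave `S_{d-1} = 0` and `S_d = 1`, that is `sin (dθ) = 0` and `sin ((d+1)θ) =
    -- sin θ` with `θ = 2π / M i j`.
    have hcos : Real.cos (d * (2 * (Real.pi / M i j))) = 1 :=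
      mul_right_cancel₀ hs.ne' (by linarith)
    obtain ⟨n, hn⟩ := (Real.cos_eq_one_iff _).1 hcos
    have hm' : (M i j : ℝ) ≠ 0 := by exact_mod_cast h0
    have : (n : ℝ) * M i j = d := by
      have hpi := Real.pi_ne_zero
      field_simp at hn
      linarith
    have : (n : ℤ) * M i j = d := by exact_mod_cast this
    exact Int.natCast_dvd_natCast.1 ⟨n, by rw [← this, mul_comm]⟩

end CoxeterMatrix

/-! ### Exact orders, distinctness of generators, and reduced braid words. -/

namespace CoxeterSystem

variable {B W : Type*} [Group W] {M : CoxeterMatrix B} (cs : CoxeterSystem M W)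

theorem orderOf_simple_mul_simple (i j : B) : orderOf (cs.simple i * cs.simple j) = M i j := by
  apply Nat.dvd_antisymm (orderOf_dvd_of_pow_eq_one (cs.simple_mul_simple_pow i j))
  rcases eq_or_ne i j with rfl | hij
  · simp
  apply M.dvd_of_geomReflection_pow_eq_one hij
  have h := congrArg (cs.lift ⟨_, M.isLiftable_geomReflection⟩)
    (pow_orderOf_eq_one (cs.simple i * cs.simple j))
  simpa only [map_pow, map_mul, lift_apply_simple, map_one] using h

theorem simple_injective : Function.Injective cs.simple := by
  intro i j h
  by_contra hij
  have h1 := cs.orderOf_simple_mul_simple i j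
  rw [h, simple_mul_simple_self, orderOf_one] at h1
  exact M.off_diagonal i j hij h1.symm

theorem simple_mem_special_iff {T : Set B} {i : B} : cs.simple i ∈ cs.special T ↔ i ∈ T := by
  refine ⟨fun h => ?_, cs.simple_mem_special⟩
  obtain ⟨ω, hT, hr, e⟩ := cs.exists_isReduced_of_mem_special h
  have h1 := hr.eq
  rw [← e, length_simple] at h1
  obtain ⟨j, rfl⟩ := List.length_eq_one_iff.1 h1.symm
  rw [wordProd_singleton] at e
  rw [cs.simple_injective e]
  exact hT j (by simp)

theorem alternatingWord_eq_drop (i j : B) (p q : ℕ) :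
    alternatingWord i j p = (alternatingWord i j (q + p)).drop q := by
  induction q with
  | zero => simp
  | succ q ih => rw [show q + 1 + p = (q + p) + 1 by ring, alternatingWord_succ']; simpa using ih

/-- Its inversions are `s_j (s_i s_j)^k` for `k < M i j`, up to order; they are distinct because
`s_i s_j` has order exactly `M i j`. -/
theorem isReduced_braidWord {i j : B} (h0 : M i j ≠ 0) : cs.IsReduced (braidWord M i j) := by
  apply isReduced_of_nodup_rightInvSeq
  rw [braidWord, alternatingWord_eq_drop i j (M i j) (M i j), rightInvSeq_drop, ← two_mul,
    ← reverse_alternatingWord_two_mul, rightInvSeq_reverse, List.drop_reverse, List.nodup_reverse,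
    leftInvSeq_alternatingWord_eq_map]
  rw [List.length_map, List.length_range, ← List.map_take, List.take_range]
  refine List.Nodup.map_on ?_ List.nodup_range
  intro a ha b hb e
  rw [List.mem_range] at ha hb
  have e' := mul_left_cancel e
  have ho := cs.orderOf_simple_mul_simple i j
  exact pow_injOn_Iio_orderOf (by simp [ho]; lia) (by simp [ho]; lia) e'

theorem simple_mul_simple_pow_eq_one_of_alternatingWord {i j : B} {q : ℕ}
    (h : cs.wordProd (alternatingWord i j q) = cs.wordProd (alternatingWord j i q)) :
    (cs.simple i * cs.simple j) ^ q = 1 := by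
  have hinv : (cs.simple i * cs.simple j)⁻¹ = cs.simple j * cs.simple i := by simp
  rw [prod_alternatingWord_eq_mul_pow, prod_alternatingWord_eq_mul_pow, ← hinv, inv_pow] at h
  rcases Nat.even_or_odd' q with ⟨k, rfl | rfl⟩
  · simp only [even_two, Even.mul_right, if_true, one_mul] at h
    rw [show 2 * k / 2 = k by lia] at h
    rw [two_mul, pow_add]
    nth_rw 1 [h]
    simp
  · have h3 : ¬ Even (2 * k + 1) := by simp
    rw [if_neg h3, if_neg h3, show (2 * k + 1) / 2 = k by lia, eq_mul_inv_iff_mul_eq] at h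
    have h4 := congrArg (cs.simple i * ·) h
    simp only [simple_mul_simple_self] at h4
    rw [show 2 * k + 1 = 1 + k + k by ring, pow_add, pow_add, pow_one, ← h4]
    simp only [mul_assoc]

end CoxeterSystem

namespace CoxeterSystem

variable {B W : Type*} [Group W] {M : CoxeterMatrix B} (cs : CoxeterSystem M W)

/-! ### Matsumoto's theorem -/

section Matsumoto

variable {G : Type*} [Group G] {f : B → G}

variable (M f) in
/-- A function on `B` satisfies the braid relations of `M`. -/
def IsBraided : Prop :=
  ∀ i j, M i j ≠ 0 → ((braidWord M i j).map f).prod = ((braidWord M j i).map f).prod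

variable (f) in
/-- Any two reduced words of length `n` for the same element have the same product under `f`. -/
def ReducedInvariant (n : ℕ) : Prop :=
  ∀ ω ω' : List B, cs.IsReduced ω → cs.IsReduced ω' → cs.wordProd ω = cs.wordProd ω' →
    ω.length = n → (ω.map f).prod = (ω'.map f).prod

theorem IsReduced.length_eq {cs : CoxeterSystem M W} {ω ω' : List B} (h : cs.IsReduced ω)
    (h' : cs.IsReduced ω') (e : cs.wordProd ω = cs.wordProd ω') : ω.length = ω'.length := by
  rw [← h.eq, ← h'.eq, e]

variable {cs}

theorem ReducedInvariant.cons {n : ℕ} (hn : ReducedInvariant cs f n) {i : B} {ω ω' : List B}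
    (h : cs.IsReduced (i :: ω)) (h' : cs.IsReduced (i :: ω'))
    (e : cs.wordProd (i :: ω) = cs.wordProd (i :: ω')) (hl : ω.length = n) :
    ((i :: ω).map f).prod = ((i :: ω').map f).prod := by
  rw [wordProd_cons, wordProd_cons, mul_right_inj] at e
  rw [List.map_cons, List.map_cons, List.prod_cons, List.prod_cons,
    hn ω ω' (by simpa using h.drop 1) (by simpa using h'.drop 1) e hl]

theorem ReducedInvariant.concat {n : ℕ} (hn : ReducedInvariant cs f n) {i : B} {ω ω' : List B}
    (h : cs.IsReduced (ω ++ [i])) (h' : cs.IsReduced (ω' ++ [i]))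
    (e : cs.wordProd (ω ++ [i]) = cs.wordProd (ω' ++ [i])) (hl : ω.length = n) :
    ((ω ++ [i]).map f).prod = ((ω' ++ [i]).map f).prod := by
  rw [wordProd_append, wordProd_append, mul_left_inj] at e
  rw [List.map_append, List.map_append, List.prod_append, List.prod_append,
    hn ω ω' (by simpa using h.take ω.length) (by simpa using h'.take ω'.length) e hl]

/-- The exchange step in the proof of Matsumoto's theorem. -/
theorem ReducedInvariant.exchange {n : ℕ} (hn : ReducedInvariant cs f n) {i c : B}
    {τ σ : List B} (h : cs.IsReduced (τ ++ [c])) (h' : cs.IsReduced (i :: σ))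
    (e : cs.wordProd (τ ++ [c]) = cs.wordProd (i :: σ)) (hl : τ.length = n)
    (hne : ((τ ++ [c]).map f).prod ≠ ((i :: σ).map f).prod) :
    cs.IsReduced (i :: τ) ∧ cs.wordProd (i :: τ) = cs.wordProd (τ ++ [c]) ∧
      ((i :: τ).map f).prod ≠ ((τ ++ [c]).map f).prod := by
  have hlen := h.length_eq h' e
  simp only [List.length_append, List.length_cons, List.length_nil, zero_add,
    add_left_inj] at hlen
  have hd : cs.IsLeftDescent (cs.wordProd (τ ++ [c])) i := by
    have h1 := (h'.drop 1).eq
    simp only [List.drop_succ_cons, List.drop_zero] at h1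
    rw [IsLeftDescent, h.eq, e, wordProd_cons, simple_mul_simple_cancel_left, h1]
    simp [hlen]
  obtain ⟨j, hj, ej⟩ := cs.exists_eraseIdx_of_isLeftDescent hd
  have ej' : cs.wordProd (i :: (τ ++ [c]).eraseIdx j) = cs.wordProd (τ ++ [c]) := by
    rw [wordProd_cons, ← ej, simple_mul_simple_cancel_left]
  have hlj := List.length_eraseIdx_add_one hj
  have hred : cs.IsReduced (i :: (τ ++ [c]).eraseIdx j) := by
    rw [IsReduced, ej', h.eq, List.length_cons, hlj]
  simp only [List.length_append, List.length_cons, List.length_nil, zero_add] at hj hlj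
  have h1 : ((i :: (τ ++ [c]).eraseIdx j).map f).prod = ((i :: σ).map f).prod :=
    hn.cons hred h' (ej'.trans e) (by lia)
  -- If the deleted letter lay in `τ`, the new word would start with `i` and end with `c`, hence
  -- agree under `f` with both given words.
  rcases lt_or_ge j τ.length with hlt | hge
  · exfalso
    rw [List.eraseIdx_append_of_lt_length hlt] at h1 ej' hred hlj
    have h2 := hn.concat (ω := i :: τ.eraseIdx j) (ω' := τ) hred h ej'
      (by simp at hlj ⊢; lia)
    exact hne (h2.symm.trans h1)
  · have : j = τ.length := by lia
    subst this
    have e0 : (τ ++ [c]).eraseIdx τ.length = τ := by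
      rw [List.eraseIdx_append_of_length_le le_rfl]; simp
    rw [e0] at h1 ej' hred
    exact ⟨hred, ej', h1 ▸ hne.symm⟩

/-- Iterating the exchange step produces a pair of reduced words one of which begins with an
alternating word of length `k`. -/
theorem ReducedInvariant.exists_alternatingWord_append {n : ℕ} (hn : ReducedInvariant cs f n)
    {a b : B} {σ σ' : List B} (h : cs.IsReduced (a :: σ)) (h' : cs.IsReduced (b :: σ'))
    (e : cs.wordProd (a :: σ) = cs.wordProd (b :: σ')) (hl : σ.length = n)
    (hne : ((a :: σ).map f).prod ≠ ((b :: σ').map f).prod) (k : ℕ) (hk : k ≤ n) :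
    ∃ ρ σ'' : List B, (k + 1) + ρ.length = n + 1 ∧
      cs.IsReduced (alternatingWord b a (k + 1) ++ ρ) ∧
      cs.IsReduced ((if Even (k + 1) then a else b) :: σ'') ∧
      cs.wordProd (alternatingWord b a (k + 1) ++ ρ) =
        cs.wordProd ((if Even (k + 1) then a else b) :: σ'') ∧
      ((alternatingWord b a (k + 1) ++ ρ).map f).prod ≠
        (((if Even (k + 1) then a else b) :: σ'').map f).prod := by
  induction k with
  | zero =>
    refine ⟨σ, σ', by lia, ?_⟩
    simpa [alternatingWord] using ⟨h, h', e, by simpa using hne⟩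
  | succ k ih =>
    obtain ⟨ρ, σ'', hlen, h1, h2, h3, h4⟩ := ih (by lia)
    have hρ : ρ ≠ [] := by rintro rfl; simp at hlen; lia
    obtain ⟨ρ, c, rfl⟩ := List.eq_nil_or_concat ρ |>.resolve_left hρ
    rw [List.length_concat] at hlen
    rw [List.concat_eq_append, ← List.append_assoc] at h1 h3 h4
    -- Each exchange drops the last letter and prepends the other of `a`, `b`; the old word becomes
    -- the second member of the new pair.
    obtain ⟨r1, r2, r3⟩ := hn.exchange h1 h2 h3 (by simp; lia) h4
    have hw : alternatingWord b a (k + 1 + 1) =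
        (if Even (k + 1) then a else b) :: alternatingWord b a (k + 1) :=
      alternatingWord_succ' b a (k + 1)
    have hpar : (if Even (k + 1 + 1) then a else b) = if Even k then a else b := by
      have : Even (k + 1 + 1) ↔ Even k := by simp [parity_simps]
      simp only [this]
    have hw' : alternatingWord b a (k + 1) = (if Even k then a else b) :: alternatingWord b a k :=
      alternatingWord_succ' b a k
    refine ⟨ρ, alternatingWord b a k ++ ρ ++ [c], by lia, ?_⟩
    rw [hw, hpar, List.cons_append]
    simp only [hw', List.cons_append] at h1 r2 r3 r1 ⊢
    exact ⟨r1, h1, r2, r3⟩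

theorem ReducedInvariant.succ (hf : IsBraided M f) {n : ℕ} (hn : ReducedInvariant cs f n) :
    ReducedInvariant cs f (n + 1) := by
  intro ω ω' h h' e hl
  by_contra hne
  have hl' := h.length_eq h' e
  rcases ω with _ | ⟨a, σ⟩
  · simp at hl
  rcases ω' with _ | ⟨b, σ'⟩
  · simp at hl'
  simp only [List.length_cons, add_left_inj] at hl
  obtain ⟨ρ, σ'', hlen, h1, h2, h3, h4⟩ :=
    hn.exists_alternatingWord_append h h' e hl hne n le_rfl
  have hρ : ρ = [] := List.length_eq_zero_iff.1 (by lia)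
  subst hρ
  rw [List.append_nil, alternatingWord_succ, List.concat_eq_append] at h1 h3 h4
  obtain ⟨r1, r2, r3⟩ := hn.exchange h1 h2 h3 (by simp) h4
  have hw : alternatingWord a b (n + 1) =
      (if Even (n + 1) then a else b) :: alternatingWord a b n := by
    rw [alternatingWord_succ']
    by_cases hp : Even n <;> simp [hp, parity_simps]
  rw [← List.concat_eq_append, ← alternatingWord_succ] at h1 r2 r3
  rw [← hw] at r1 r2 r3
  -- Both words are now fully alternating. Equality in `W` makes `M a b` divide `n + 1`, reducedness
  -- gives `n + 1 ≤ M a b`, and what remains is a braid relation.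
  have hpow := cs.simple_mul_simple_pow_eq_one_of_alternatingWord r2
  have hdvd := orderOf_dvd_of_pow_eq_one hpow
  rw [orderOf_simple_mul_simple] at hdvd
  have h0 : M a b ≠ 0 := by
    intro h0
    rw [h0, zero_dvd_iff] at hdvd
    lia
  have hle : n + 1 ≤ M a b := by
    by_contra hlt
    exact cs.not_isReduced_alternatingWord a b h0 (by lia) r1
  have heq : n + 1 = M a b := le_antisymm hle (Nat.le_of_dvd (by lia) hdvd)
  apply r3
  have := hf a b h0
  rw [braidWord, braidWord, M.symmetric b a, ← heq] at this
  exact this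

/-- **Matsumoto's theorem**: a function satisfying the braid relations takes the same value on any
two reduced words for the same element. -/
theorem IsReduced.prod_map_eq (hf : IsBraided M f) {ω ω' : List B} (h : cs.IsReduced ω)
    (h' : cs.IsReduced ω') (e : cs.wordProd ω = cs.wordProd ω') :
    (ω.map f).prod = (ω'.map f).prod := by
  have key : ∀ n, ReducedInvariant cs f n := by
    intro n
    induction n with
    | zero =>
      intro ω ω' h h' e hl
      have hl' := h.length_eq h' e
      rw [hl] at hl'
      rw [List.length_eq_zero_iff.1 hl, List.length_eq_zero_iff.1 hl'.symm]
    | succ n ih => exact ih.succ hf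
  exact key _ ω ω' h h' e rfl

end Matsumoto

/-! ### The lift to the Artin group -/

theorem isBraided_artinGen : IsBraided M M.artinGen := by
  intro i j h0
  have hr : M.braidProd i j * (M.braidProd j i)⁻¹ ∈ M.artinRelators := ⟨i, j, h0, rfl⟩
  have h := PresentedGroup.one_of_mem hr
  rw [map_mul, map_inv, mul_inv_eq_one] at h
  simp only [CoxeterMatrix.braidProd, map_list_prod, List.map_map] at h
  exact h

theorem artinLift_wordProd {ω : List B} (h : cs.IsReduced ω) :
    cs.artinLift (cs.wordProd ω) = (ω.map M.artinGen).prod := by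
  have hs := (cs.exists_isReduced (cs.wordProd ω)).choose_spec
  exact (h.prod_map_eq isBraided_artinGen hs.1 hs.2).symm

theorem artinLift_mul_simple {w : W} {i : B} (h : cs.IsRightDescent w i) :
    cs.artinLift w = cs.artinLift (w * cs.simple i) * M.artinGen i := by
  obtain ⟨ω, hω, e⟩ := cs.exists_isReduced (w * cs.simple i)
  have ew : w = cs.wordProd (ω ++ [i]) := by
    rw [wordProd_append, ← e, wordProd_singleton, simple_mul_simple_cancel_right]
  have hr : cs.IsReduced (ω ++ [i]) := by
    rw [isRightDescent_iff, e, hω.eq] at h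
    rw [IsReduced, ← ew, ← h]
    simp
  rw [e, artinLift_wordProd cs hω]
  nth_rw 1 [ew]
  rw [artinLift_wordProd cs hr]
  simp

theorem artinLift_simple_mul {w : W} {i : B} (h : cs.IsLeftDescent w i) :
    cs.artinLift w = M.artinGen i * cs.artinLift (cs.simple i * w) := by
  obtain ⟨ω, hω, e⟩ := cs.exists_isReduced (cs.simple i * w)
  have ew : w = cs.wordProd (i :: ω) := by
    rw [wordProd_cons, ← e, simple_mul_simple_cancel_left]
  have hr : cs.IsReduced (i :: ω) := by
    rw [isLeftDescent_iff, e, hω.eq] at h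
    rw [IsReduced, ← ew, ← h]
    simp
  rw [e, artinLift_wordProd cs hω]
  nth_rw 1 [ew]
  rw [artinLift_wordProd cs hr]
  simp

/-- Split `a_j` off the left of `a_u`; the remainder `a_{s_j u} = a_{u s_i}` absorbs `a_i` to give
`a_u` back. -/
theorem artinLift_mul_artinGen {u : W} {i j : B} (h : u * cs.simple i = cs.simple j * u)
    (hd : cs.IsRightDescent u i) :
    cs.artinLift u * M.artinGen i = M.artinGen j * cs.artinLift u := by
  have hd' : cs.IsLeftDescent u j := by rwa [IsLeftDescent, ← h]
  nth_rw 2 [cs.artinLift_mul_simple hd]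
  rw [cs.artinLift_simple_mul hd', ← h, mul_assoc]

/-- The submonoid of the Artin group generated by the `a_s` with `s ∈ X`. -/
def _root_.CoxeterMatrix.artinPositive (M : CoxeterMatrix B) (X : Set B) :
    Submonoid M.ArtinGroup :=
  Submonoid.closure (M.artinGen '' X)

theorem _root_.CoxeterMatrix.artinGen_mem_artinPositive {X : Set B} {i : B} (h : i ∈ X) :
    M.artinGen i ∈ M.artinPositive X :=
  Submonoid.subset_closure ⟨i, h, rfl⟩

theorem _root_.CoxeterMatrix.artinPositive_mono {X Y : Set B} (h : X ⊆ Y) :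
    M.artinPositive X ≤ M.artinPositive Y :=
  Submonoid.closure_mono (Set.image_mono h)

theorem artinLift_mem_artinPositive {T : Set B} {w : W} (hw : w ∈ cs.special T) :
    cs.artinLift w ∈ M.artinPositive T := by
  obtain ⟨ω, hT, hr, rfl⟩ := cs.exists_isReduced_of_mem_special hw
  rw [cs.artinLift_wordProd hr]
  refine Submonoid.list_prod_mem _ fun x hx => ?_
  obtain ⟨i, hi, rfl⟩ := List.mem_map.1 hx
  exact M.artinGen_mem_artinPositive (hT i hi)

/-! ### The elements `δ_T` -/

theorem longest_mem (T : cs.IrrSpherical) : cs.longest T ∈ cs.special T.1 :=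
  (cs.exists_longest T.2.1).choose_spec.1

theorem length_le_longest (T : cs.IrrSpherical) :
    ∀ v ∈ cs.special T.1, cs.length v ≤ cs.length (cs.longest T) :=
  (cs.exists_longest T.2.1).choose_spec.2

theorem isRightDescent_longest (T : cs.IrrSpherical) {i : B} (hi : i ∈ T.1) :
    cs.IsRightDescent (cs.longest T) i :=
  lt_of_le_of_ne
    (cs.length_le_longest T _ (mul_mem (cs.longest_mem T) (cs.simple_mem_special hi)))
    (cs.length_mul_simple_ne _ _)

theorem artinDelta_mem (T : cs.IrrSpherical) : cs.artinDelta T ∈ M.artinPositive T.1 :=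
  cs.artinLift_mem_artinPositive (cs.longest_mem T)

theorem artinCentral_mem (T : cs.IrrSpherical) : cs.artinCentral T ∈ M.artinPositive T.1 := by
  unfold artinCentral
  split_ifs
  · exact cs.artinDelta_mem T
  · exact pow_mem (cs.artinDelta_mem T) 2

theorem exists_artinCentral_eq_mul (T : cs.IrrSpherical) {i : B} (hi : i ∈ T.1) :
    ∃ p ∈ M.artinPositive T.1, cs.artinCentral T = p * M.artinGen i := by
  have hp : cs.artinLift (cs.longest T * cs.simple i) ∈ M.artinPositive T.1 :=
    cs.artinLift_mem_artinPositive (mul_mem (cs.longest_mem T) (cs.simple_mem_special hi))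
  have e : cs.artinDelta T = cs.artinLift (cs.longest T * cs.simple i) * M.artinGen i :=
    cs.artinLift_mul_simple (cs.isRightDescent_longest T hi)
  unfold artinCentral
  split_ifs
  · exact ⟨_, hp, e⟩
  · refine ⟨_, mul_mem (cs.artinDelta_mem T) hp, ?_⟩
    rw [pow_two]
    nth_rw 2 [e]
    rw [mul_assoc]

/-- `δ_T` is central in the subgroup generated by the `a_t` with `t ∈ T`. -/
theorem commute_artinCentral_artinGen (T : cs.IrrSpherical) {i : B} (hi : i ∈ T.1) :
    Commute (cs.artinCentral T) (M.artinGen i) := by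
  have hd := cs.isRightDescent_longest T hi
  unfold artinCentral
  split_ifs with h
  · exact cs.artinLift_mul_artinGen (mul_inv_eq_iff_eq_mul.1 (h i hi)) hd
  · obtain ⟨j, hj⟩ :=
      cs.exists_conj_simple_eq_simple (cs.longest_mem T) (cs.length_le_longest T) hi
    have hsq := mul_self_eq_one_of_forall_length_le (cs.longest_mem T) (cs.length_le_longest T)
    -- Conjugation by the involution `w_T` swaps `s_i` and `s_j`, so passing `a_i` through `Δ_T`
    -- twice restores it.
    have hj' : cs.longest T * cs.simple j = cs.simple i * cs.longest T := by
      have e : cs.simple j = cs.longest T * cs.simple i * (cs.longest T)⁻¹ := by rw [hj]; group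
      rw [e, inv_eq_of_mul_eq_one_left hsq, ← mul_assoc, ← mul_assoc, hsq, one_mul]
    have hd' : cs.IsRightDescent (cs.longest T) j := by
      have hl : cs.IsLeftDescent (cs.longest T) j := by rwa [IsLeftDescent, ← hj]
      rwa [← isLeftDescent_inv_iff, inv_eq_of_mul_eq_one_left hsq]
    rw [artinDelta, pow_two, Commute, SemiconjBy, mul_assoc, cs.artinLift_mul_artinGen hj hd,
      ← mul_assoc, cs.artinLift_mul_artinGen hj' hd', mul_assoc]

theorem _root_.CoxeterMatrix.commute_artinGen {i j : B} (h : M i j = 2) :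
    Commute (M.artinGen i) (M.artinGen j) := by
  have h1 := isBraided_artinGen (M := M) i j (by rw [h]; lia)
  rw [braidWord, braidWord, M.symmetric j i, h] at h1
  simpa [alternatingWord, Commute, SemiconjBy] using h1

theorem _root_.CoxeterMatrix.commute_of_mem_artinPositive {X : Set B} {g p : M.ArtinGroup}
    (h : ∀ i ∈ X, Commute g (M.artinGen i)) (hp : p ∈ M.artinPositive X) : Commute g p := by
  induction hp using Submonoid.closure_induction with
  | mem x hx => obtain ⟨i, hi, rfl⟩ := hx; exact h i hi
  | one => exact Commute.one_right g
  | mul x y _ _ hx hy => exact hx.mul_right hy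

theorem commute_artinCentral_of_subset {T T' : cs.IrrSpherical} (h : T'.1 ⊆ T.1) :
    Commute (cs.artinCentral T) (cs.artinCentral T') :=
  M.commute_of_mem_artinPositive (fun _ hi => cs.commute_artinCentral_artinGen T (h hi))
    (cs.artinCentral_mem T')

theorem commute_artinCentral_of_orthogonal {T T' : cs.IrrSpherical}
    (h : ∀ i ∈ T.1, ∀ j ∈ T'.1, M i j = 2) :
    Commute (cs.artinCentral T) (cs.artinCentral T') :=
  M.commute_of_mem_artinPositive (fun j hj =>
    (M.commute_of_mem_artinPositive (fun i hi => (M.commute_artinGen (h i hi j hj)).symm)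
      (cs.artinCentral_mem T)).symm) (cs.artinCentral_mem T')

end CoxeterSystem

namespace CoxeterSystem

variable {B W : Type*} [Group W] {M : CoxeterMatrix B} (cs : CoxeterSystem M W)

/-! ### The Hecke representation at `q = 2` -/

open Classical in
/-- The left Hecke operator of `s` at `q = 2`, acting on functions on `W`. -/
noncomputable def heckeLeft (i : B) : Module.End ℚ (W → ℚ) where
  toFun v w := if cs.IsLeftDescent w i then v (cs.simple i * w) + v w else 2 * v (cs.simple i * w)
  map_add' u v := by
    funext w
    simp only [Pi.add_apply]
    split_ifs <;> ring
  map_smul' c v := by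
    funext w
    simp only [Pi.smul_apply, smul_eq_mul, RingHom.id_apply]
    split_ifs <;> ring

open Classical in
/-- The right Hecke operator of `s` at `q = 2`, acting on functions on `W`. -/
noncomputable def heckeRight (i : B) : Module.End ℚ (W → ℚ) where
  toFun v w :=
    if cs.IsRightDescent w i then v (w * cs.simple i) + v w else 2 * v (w * cs.simple i)
  map_add' u v := by
    funext w
    simp only [Pi.add_apply]
    split_ifs <;> ring
  map_smul' c v := by
    funext w
    simp only [Pi.smul_apply, smul_eq_mul, RingHom.id_apply]
    split_ifs <;> ring

open Classical in
theorem heckeLeft_apply (i : B) (v : W → ℚ) (w : W) :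
    cs.heckeLeft i v w =
      if cs.IsLeftDescent w i then v (cs.simple i * w) + v w else 2 * v (cs.simple i * w) := rfl

open Classical in
theorem heckeRight_apply (i : B) (v : W → ℚ) (w : W) :
    cs.heckeRight i v w =
      if cs.IsRightDescent w i then v (w * cs.simple i) + v w else 2 * v (w * cs.simple i) := rfl

/-- The two sides agree by inspection of descents, except where left multiplication by `s_i` changes
whether `j` is a right descent; there `s_i w = w s_j`. -/
theorem commute_heckeLeft_heckeRight (i j : B) :
    Commute (cs.heckeLeft i) (cs.heckeRight j) := by
  refine LinearMap.ext fun v => funext fun w => ?_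
  simp only [Module.End.mul_apply, heckeLeft_apply, heckeRight_apply]
  have key := cs.simple_mul_eq_mul_simple_of_isRightDescent (w := w) (i := i) (j := j)
  have h1 := cs.length_simple_mul w i
  have h2 := cs.length_mul_simple w j
  have h3 := cs.length_mul_simple (cs.simple i * w) j
  have h4 := cs.length_simple_mul (w * cs.simple j) i
  unfold IsLeftDescent IsRightDescent at *
  rw [← mul_assoc (cs.simple i) w (cs.simple j)] at *
  split_ifs <;> first
    | ring1
    | (exfalso; lia)
    | linarith [congrArg v (key (by lia))]

theorem prod_map_heckeLeft_apply_one {ω : List B} (h : cs.IsReduced ω) (v : W → ℚ) :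
    (ω.map cs.heckeLeft).prod v 1 = 2 ^ ω.length * v (cs.wordProd ω)⁻¹ := by
  induction ω using List.reverseRecOn generalizing v with
  | nil => simp
  | append_singleton ω i ih =>
    have hω : cs.IsReduced ω := by simpa using h.take ω.length
    rw [List.map_append, List.prod_append, Module.End.mul_apply, ih hω]
    simp only [List.map_cons, List.map_nil, List.prod_singleton]
    rw [heckeLeft_apply, if_neg]
    · simp [wordProd_append, pow_succ, mul_assoc]
    · have h1 := h.eq
      rw [wordProd_append, wordProd_singleton, List.length_append, List.length_singleton,
        ← hω.eq, ← not_isRightDescent_iff] at h1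
      rwa [isLeftDescent_inv_iff]

/-- Right operators carry evaluation at `1` to evaluation at any `w`. An operator commuting with
them is therefore determined by its values at `1`, which yields the braid relations for the left
operators. -/
theorem exists_prod_map_heckeRight_apply_one (w : W) :
    ∃ R : Module.End ℚ (W → ℚ), (∀ i, Commute (cs.heckeLeft i) R) ∧
      ∃ c : ℚ, c ≠ 0 ∧ ∀ v, R v 1 = c * v w := by
  obtain ⟨ω, hω, rfl⟩ := cs.exists_isReduced w
  induction ω using List.reverseRecOn with
  | nil => exact ⟨1, fun i => Commute.one_right _, 1, one_ne_zero, by simp⟩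
  | append_singleton ω i ih =>
    have hω' : cs.IsReduced ω := by simpa using hω.take ω.length
    obtain ⟨R, hR, c, hc, e⟩ := ih hω'
    refine ⟨R * cs.heckeRight i,
      fun k => (hR k).mul_right (cs.commute_heckeLeft_heckeRight k i), c * 2, by simpa, fun v => ?_⟩
    rw [Module.End.mul_apply, e, heckeRight_apply, if_neg, wordProd_append, wordProd_singleton,
      mul_assoc]
    have h1 := hω.eq
    rwa [wordProd_append, wordProd_singleton, List.length_append, List.length_singleton,
      ← hω'.eq, ← not_isRightDescent_iff] at h1

theorem prod_map_heckeLeft_eq {ω ω' : List B} (h : cs.IsReduced ω) (h' : cs.IsReduced ω')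
    (e : cs.wordProd ω = cs.wordProd ω') :
    (ω.map cs.heckeLeft).prod = (ω'.map cs.heckeLeft).prod := by
  refine LinearMap.ext fun v => funext fun w => ?_
  obtain ⟨R, hR, c, hc, hRc⟩ := cs.exists_prod_map_heckeRight_apply_one w
  have hcomm : ∀ ω : List B, Commute (ω.map cs.heckeLeft).prod R := fun ω =>
    Commute.list_prod_left _ _ fun x hx => by
      obtain ⟨i, -, rfl⟩ := List.mem_map.1 hx; exact hR i
  apply mul_left_cancel₀ hc
  rw [← hRc, ← hRc, ← Module.End.mul_apply, ← Module.End.mul_apply, ← (hcomm ω).eq,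
    ← (hcomm ω').eq, Module.End.mul_apply, Module.End.mul_apply,
    cs.prod_map_heckeLeft_apply_one h, cs.prod_map_heckeLeft_apply_one h', e, h.length_eq h' e]

theorem heckeLeft_mul_self (i : B) :
    cs.heckeLeft i * cs.heckeLeft i = cs.heckeLeft i + 2 := by
  refine LinearMap.ext fun v => funext fun w => ?_
  have h2 : (2 : Module.End ℚ (W → ℚ)) v = (2 : ℚ) • v := by
    rw [← one_add_one_eq_two, LinearMap.add_apply, Module.End.one_apply, two_smul]
  rw [LinearMap.add_apply, h2]
  simp only [Module.End.mul_apply, heckeLeft_apply, Pi.add_apply, Pi.smul_apply, smul_eq_mul,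
    simple_mul_simple_cancel_left]
  have h := cs.isLeftDescent_iff_not_isLeftDescent_mul (w := w) (i := i)
  split_ifs <;> first | ring1 | tauto

/-- The left Hecke operators are invertible. -/
noncomputable def heckeUnit (i : B) : (Module.End ℚ (W → ℚ))ˣ where
  val := cs.heckeLeft i
  inv := (2⁻¹ : ℚ) • (cs.heckeLeft i - 1)
  val_inv := by
    rw [mul_smul_comm, mul_sub, heckeLeft_mul_self, mul_one, add_sub_cancel_left,
      inv_smul_eq_iff₀ two_ne_zero, two_smul, one_add_one_eq_two]
  inv_val := by
    rw [smul_mul_assoc, sub_mul, heckeLeft_mul_self, one_mul, add_sub_cancel_left,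
      inv_smul_eq_iff₀ two_ne_zero, two_smul, one_add_one_eq_two]

theorem val_prod_map_heckeUnit (ω : List B) :
    ((ω.map cs.heckeUnit).prod : Module.End ℚ (W → ℚ)) = (ω.map cs.heckeLeft).prod := by
  rw [← Units.coeHom_apply, map_list_prod, List.map_map]
  rfl

/-- The Hecke representation of the Artin group at `q = 2`. -/
noncomputable def heckeRep : M.ArtinGroup →* (Module.End ℚ (W → ℚ))ˣ :=
  PresentedGroup.toGroup (f := cs.heckeUnit) (by
    rintro _ ⟨i, j, h0, rfl⟩
    have h0' : M j i ≠ 0 := by rwa [M.symmetric j i]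
    rw [map_mul, map_inv, mul_inv_eq_one, CoxeterMatrix.braidProd, CoxeterMatrix.braidProd,
      map_list_prod, map_list_prod, List.map_map, List.map_map]
    have e : (⇑(FreeGroup.lift cs.heckeUnit) ∘ FreeGroup.of) = cs.heckeUnit := by
      funext k; simp
    rw [e, Units.ext_iff, val_prod_map_heckeUnit, val_prod_map_heckeUnit]
    exact cs.prod_map_heckeLeft_eq (cs.isReduced_braidWord h0) (cs.isReduced_braidWord h0')
      (cs.wordProd_braidWord_eq i j))

theorem heckeRep_artinGen (i : B) :
    (cs.heckeRep (M.artinGen i) : Module.End ℚ (W → ℚ)) = cs.heckeLeft i := by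
  rw [CoxeterMatrix.artinGen, heckeRep, PresentedGroup.toGroup.of]
  rfl

theorem heckeRep_mul_apply (g h : M.ArtinGroup) (v : W → ℚ) :
    (cs.heckeRep (g * h) : Module.End ℚ (W → ℚ)) v =
      (cs.heckeRep g : Module.End ℚ (W → ℚ)) ((cs.heckeRep h : Module.End ℚ (W → ℚ)) v) := by
  rw [map_mul, Units.val_mul, Module.End.mul_apply]

theorem heckeLeft_nonneg (i : B) {v : W → ℚ} (hv : 0 ≤ v) : 0 ≤ cs.heckeLeft i v := by
  intro w
  have h1 := hv w
  have h2 := hv (cs.simple i * w)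
  simp only [Pi.zero_apply] at h1 h2
  rw [heckeLeft_apply, Pi.zero_apply]
  split_ifs <;> positivity

theorem heckeLeft_apply_pos (i : B) {v : W → ℚ} (hv : 0 ≤ v) {w : W} (hw : 0 < v w) :
    0 < cs.heckeLeft i v (cs.simple i * w) := by
  have h2 := hv (cs.simple i * w)
  simp only [Pi.zero_apply] at h2
  rw [heckeLeft_apply, simple_mul_simple_cancel_left]
  split_ifs <;> positivity

theorem heckeRep_induction {X : Set B} {P : (W → ℚ) → Prop}
    (h : ∀ i ∈ X, ∀ v, P v → P (cs.heckeLeft i v)) {p : M.ArtinGroup}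
    (hp : p ∈ M.artinPositive X) {v : W → ℚ} (hv : P v) :
    P ((cs.heckeRep p : Module.End ℚ (W → ℚ)) v) := by
  induction hp using Submonoid.closure_induction_left with
  | one => simpa using hv
  | mul_left x hx y _ ih =>
    obtain ⟨i, hi, rfl⟩ := hx
    rw [heckeRep_mul_apply, heckeRep_artinGen]
    exact h i hi _ ih

open Classical in
/-- A positive element of the Artin group involving `a_s` is not a positive element in generators
other than `a_s`. -/
theorem mul_artinGen_mul_notMem_artinPositive (cs : CoxeterSystem M W) {X : Set B} {i : B}
    (hi : i ∉ X)
    {p p' : M.ArtinGroup} (hp : p ∈ M.artinPositive Set.univ)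
    (hp' : p' ∈ M.artinPositive Set.univ) :
    p * M.artinGen i * p' ∉ M.artinPositive X := by
  intro hmem
  -- Letters of `X` preserve `W_X` under left multiplication, so the image of the indicator of `1`
  -- stays supported there.
  have h1 : ∀ w ∉ cs.special X,
      (cs.heckeRep (p * M.artinGen i * p') : Module.End ℚ (W → ℚ)) (Pi.single 1 1) w = 0 := by
    refine cs.heckeRep_induction (P := fun v => ∀ w ∉ cs.special X, v w = 0) ?_ hmem ?_
    · intro k hk v hv w hw
      have hw' : cs.simple k * w ∉ cs.special X := fun h =>
        hw ((Subgroup.mul_mem_cancel_left _ (cs.simple_mem_special hk)).1 h)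
      rw [heckeLeft_apply, hv _ hw, hv _ hw']
      simp
    · intro w hw
      rw [Pi.single_eq_of_ne]
      rintro rfl
      exact hw (one_mem _)
  have h2 : 0 ≤ (cs.heckeRep p' : Module.End ℚ (W → ℚ)) (Pi.single 1 1) ∧
      ∃ w, 0 < (cs.heckeRep p' : Module.End ℚ (W → ℚ)) (Pi.single 1 1) w := by
    refine cs.heckeRep_induction (P := fun v => 0 ≤ v ∧ ∃ w, 0 < v w) ?_ hp' ?_
    · rintro k - v ⟨hv, w, hw⟩
      exact ⟨cs.heckeLeft_nonneg k hv, _, cs.heckeLeft_apply_pos k hv hw⟩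
    · exact ⟨Pi.single_nonneg.2 zero_le_one, 1, by simp⟩
  -- At a left descent the diagonal coefficient `q - 1 = 1` keeps the value at `w` positive;
  -- otherwise it moves up to `s_k w`, still outside `W_X`.
  have h3 : ∀ (k : B) (v : W → ℚ), 0 ≤ v → ∀ w, 0 < v w → w ∉ cs.special X →
      ∃ w ∉ cs.special X, 0 < cs.heckeLeft k v w := by
    intro k v hv w hw hwX
    by_cases hd : cs.IsLeftDescent w k
    · refine ⟨w, hwX, ?_⟩
      have h2 := hv (cs.simple k * w)
      simp only [Pi.zero_apply] at h2
      rw [heckeLeft_apply, if_pos hd]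
      positivity
    · exact ⟨_, fun h => hwX (cs.mem_special_of_simple_mul_mem h hd),
        cs.heckeLeft_apply_pos k hv hw⟩
  have h4 : 0 ≤ (cs.heckeRep (p * M.artinGen i * p') : Module.End ℚ (W → ℚ)) (Pi.single 1 1) ∧
      ∃ w ∉ cs.special X,
        0 < (cs.heckeRep (p * M.artinGen i * p') : Module.End ℚ (W → ℚ)) (Pi.single 1 1) w := by
    rw [heckeRep_mul_apply, heckeRep_mul_apply]
    refine cs.heckeRep_induction (P := fun v => 0 ≤ v ∧ ∃ w ∉ cs.special X, 0 < v w) ?_ hp ?_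
    · rintro k - v ⟨hv, w, hwX, hw⟩
      exact ⟨cs.heckeLeft_nonneg k hv, h3 k v hv w hw hwX⟩
    · rw [heckeRep_artinGen]
      obtain ⟨hv, w, hw⟩ := h2
      refine ⟨cs.heckeLeft_nonneg i hv, ?_⟩
      by_cases hwX : w ∈ cs.special X
      · refine ⟨_, fun h => hi ?_, cs.heckeLeft_apply_pos i hv hw⟩
        rwa [Subgroup.mul_mem_cancel_right _ hwX, simple_mem_special_iff] at h
      · exact h3 i _ hv w hw hwX
  obtain ⟨-, w, hwX, hw⟩ := h4
  exact hw.ne' (h1 w hwX)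

end CoxeterSystem

namespace CoxeterSystem

variable {B W : Type*} [Group W] {M : CoxeterMatrix B} (cs : CoxeterSystem M W)

/-! ### Nested sets -/

theorem _root_.CoxeterMatrix.orthogonal_of_mem_decomposition {X C C' : Set B}
    (hC : C ∈ M.decomposition X) (hC' : C' ∈ M.decomposition X) (hne : C ≠ C') :
    ∀ i ∈ C, ∀ j ∈ C', i ≠ j ∧ M i j = 2 := by
  obtain ⟨c, rfl⟩ := hC
  obtain ⟨c', rfl⟩ := hC'
  rintro _ ⟨x, hx, rfl⟩ _ ⟨y, hy, rfl⟩
  rw [SimpleGraph.ConnectedComponent.mem_supp_iff] at hx hy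
  have hxy : x.1 ≠ y.1 := by
    intro h
    have := Subtype.ext h
    subst this
    exact hne (by rw [← hx, ← hy])
  refine ⟨hxy, ?_⟩
  by_contra h
  have hadj : (M.diagram.induce X).Adj x y := ⟨hxy, h⟩
  exact hne (by rw [← hx, ← hy, SimpleGraph.ConnectedComponent.sound hadj.reachable])

theorem _root_.CoxeterMatrix.mem_decomposition_self {X : Set B}
    (hX : (M.diagram.induce X).Connected) : X ∈ M.decomposition X := by
  obtain ⟨x⟩ := hX.nonempty
  refine ⟨(M.diagram.induce X).connectedComponentMk x, ?_⟩
  ext b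
  simp only [Set.mem_image, SimpleGraph.ConnectedComponent.mem_supp_iff, Subtype.exists,
    exists_and_right, exists_eq_right]
  exact ⟨fun hb => ⟨hb, SimpleGraph.ConnectedComponent.sound (hX.preconnected _ _)⟩,
    fun ⟨hb, _⟩ => hb⟩

variable {cs}

/-- A connected support is its own component, hence must be one of the maximal elements. -/
theorem IsNested.mem_of_support_eq {α : Set cs.IrrSpherical} (h : cs.IsNested α)
    {T : cs.IrrSpherical} (hT : cs.support α = T.1) : T ∈ α := by
  cases h with
  | empty =>
    exfalso
    obtain ⟨x, hx⟩ := T.2.2.nonempty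
    rw [← hT] at hx
    simp [support] at hx
  | step α _ maximal _ =>
    have h1 := M.mem_decomposition_self T.2.2
    rw [← hT, ← maximal, hT] at h1
    obtain ⟨T', hT', e⟩ := h1
    rw [← Subtype.ext e]
    exact hT'.prop

/-- Two elements of a nested set are either comparable or orthogonal. -/
theorem IsNested.le_or_le_or_orthogonal {α : Set cs.IrrSpherical} (h : cs.IsNested α)
    (hα : α.Finite) {T T' : cs.IrrSpherical} (hT : T ∈ α) (hT' : T' ∈ α) :
    T ≤ T' ∨ T' ≤ T ∨ ∀ i ∈ T.1, ∀ j ∈ T'.1, i ≠ j ∧ M i j = 2 := by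
  induction h generalizing T T' with
  | empty => exact absurd hT (Set.notMem_empty _)
  | step α _ maximal _ ih =>
    obtain ⟨U, hTU, hU⟩ := hα.exists_le_maximal hT
    obtain ⟨U', hTU', hU'⟩ := hα.exists_le_maximal hT'
    by_cases hUU : U = U'
    · subst hUU
      rcases hTU.eq_or_lt with rfl | hlt
      · exact Or.inr (Or.inl hTU')
      rcases hTU'.eq_or_lt with rfl | hlt'
      · exact Or.inl hTU
      exact ih U hU (hα.subset fun _ h => h.1) ⟨hT, hlt⟩ ⟨hT', hlt'⟩
    · refine Or.inr (Or.inr fun i hi j hj => ?_)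
      have h1 : U.1 ∈ M.decomposition (cs.support α) := maximal ▸ ⟨U, hU, rfl⟩
      have h2 : U'.1 ∈ M.decomposition (cs.support α) := maximal ▸ ⟨U', hU', rfl⟩
      exact M.orthogonal_of_mem_decomposition h1 h2 (fun h => hUU (Subtype.ext h)) i (hTU hi) j
        (hTU' hj)

/-- An element of a nested set is not covered by the smaller elements of that set. -/
theorem IsNested.exists_mem_forall_lt_notMem {α : Set cs.IrrSpherical} (h : cs.IsNested α)
    (hα : α.Finite) {T : cs.IrrSpherical} (hT : T ∈ α) :
    ∃ i ∈ T.1, ∀ T' ∈ α, T' < T → i ∉ T'.1 := by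
  induction h generalizing T with
  | empty => exact absurd hT (Set.notMem_empty _)
  | step α _ maximal below ih =>
    obtain ⟨U, hTU, hU⟩ := hα.exists_le_maximal hT
    rcases hTU.eq_or_lt with rfl | hlt
    -- If the smaller elements cover `T`, their nested set has support `T` and so contains `T`,
    -- contradicting strictness.
    · by_contra! hcon
      have hs : cs.support {T' | T' ∈ α ∧ T' < T} = T.1 := by
        ext i
        simp only [support, Set.mem_ofPred_eq, Set.mem_iUnion, exists_prop]
        constructor
        · rintro ⟨T', ⟨-, hlt⟩, hi⟩
          exact hlt.le hi
        · intro hi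
          obtain ⟨T', h1, h2, h3⟩ := hcon i hi
          exact ⟨T', ⟨h1, h2⟩, h3⟩
      exact lt_irrefl T ((below T hU).mem_of_support_eq hs).2
    · obtain ⟨i, hi, h⟩ := ih U hU (hα.subset fun _ h => h.1) ⟨hT, hlt⟩
      exact ⟨i, hi, fun T' hT' hlt' => h T' ⟨hT', hlt'.trans hlt⟩ hlt'⟩

theorem IsNested.commute_artinCentral {α : Set cs.IrrSpherical} (h : cs.IsNested α)
    (hα : α.Finite) {T T' : cs.IrrSpherical} (hT : T ∈ α) (hT' : T' ∈ α) :
    Commute (cs.artinCentral T) (cs.artinCentral T') := by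
  rcases h.le_or_le_or_orthogonal hα hT hT' with h | h | h
  · exact (cs.commute_artinCentral_of_subset h).symm
  · exact cs.commute_artinCentral_of_subset h
  · exact cs.commute_artinCentral_of_orthogonal fun i hi j hj => (h i hi j hj).2

/-! ### Standard abelian subgroups -/

/-- The standard abelian subgroup of a nested set is commutative. -/
noncomputable abbrev standardAbelianCommGroup {α : Finset cs.IrrSpherical}
    (h : cs.IsNested (α : Set cs.IrrSpherical)) : CommGroup (cs.standardAbelian α) :=
  { (cs.standardAbelian α).toGroup with
    mul_comm := fun x y => by
      have hc : ∀ x ∈ cs.artinCentral '' (α : Set cs.IrrSpherical),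
          ∀ y ∈ cs.artinCentral '' (α : Set cs.IrrSpherical), x * y = y * x := by
        rintro _ ⟨T, hT, rfl⟩ _ ⟨T', hT', rfl⟩
        exact h.commute_artinCentral α.finite_toSet hT hT'
      exact (Subgroup.isMulCommutative_closure hc).is_comm.comm x y }

variable (cs) in
/-- `δ_T` as an element of the standard abelian subgroup. -/
noncomputable def standardAbelianGen (α : Finset cs.IrrSpherical) (T : {T // T ∈ α}) :
    cs.standardAbelian α :=
  ⟨cs.artinCentral T.1, Subgroup.subset_closure ⟨T.1, T.2, rfl⟩⟩

/-- No nontrivial power of `δ_T` with positive exponent times a positive element lies in the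
positive submonoid of letters missing a letter of `T`. -/
theorem artinCentral_pow_mul_notMem {X : Set B} {T : cs.IrrSpherical} {i : B} (hiT : i ∈ T.1)
    (hiX : i ∉ X) {n : ℕ} (hn : n ≠ 0) {p : M.ArtinGroup} (hp : p ∈ M.artinPositive Set.univ) :
    cs.artinCentral T ^ n * p ∉ M.artinPositive X := by
  obtain ⟨q, hq, e⟩ := cs.exists_artinCentral_eq_mul T hiT
  obtain ⟨n, rfl⟩ := Nat.exists_eq_succ_of_ne_zero hn
  have hle : M.artinPositive T.1 ≤ M.artinPositive Set.univ :=
    M.artinPositive_mono (Set.subset_univ _)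
  have h1 : cs.artinCentral T ^ (n + 1) * p =
      (cs.artinCentral T ^ n * q) * M.artinGen i * p := by
    rw [pow_succ]
    nth_rw 2 [e]
    simp only [mul_assoc]
  rw [Nat.succ_eq_add_one, h1]
  exact mul_artinGen_mul_notMem_artinPositive cs hiX
    (mul_mem (pow_mem (hle (cs.artinCentral_mem T)) n) (hle hq)) hp

end CoxeterSystem

/-! ### Linear independence of the `δ_T` and the resulting basis. -/

namespace CoxeterSystem

variable {B W : Type*} [Group W] {M : CoxeterMatrix B} {cs : CoxeterSystem M W}

theorem coe_sum_nsmul_standardAbelianGen_mem {α : Finset cs.IrrSpherical}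
    (h : cs.IsNested (α : Set cs.IrrSpherical)) (P : Submonoid M.ArtinGroup)
    (s : Finset {T // T ∈ α}) (n : {T // T ∈ α} → ℕ)
    (hn : ∀ T ∈ s, n T ≠ 0 → cs.artinCentral T.1 ∈ P) :
    letI := standardAbelianCommGroup h
    (((∑ T ∈ s, n T • Additive.ofMul (cs.standardAbelianGen α T)).toMul :
      cs.standardAbelian α) : M.ArtinGroup) ∈ P := by
  let := standardAbelianCommGroup h
  refine Finset.sum_induction (fun T => n T • Additive.ofMul (cs.standardAbelianGen α T))
    (fun x => ((x.toMul : cs.standardAbelian α) : M.ArtinGroup) ∈ P)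
    (fun a b ha hb => mul_mem ha hb) (one_mem P) fun T hT => ?_
  by_cases h0 : n T = 0
  · simp only [h0, zero_smul]
    exact one_mem P
  · exact pow_mem (hn T hT h0) (n T)

/-- In a relation between the `δ_T`, the coefficients at maximal elements of its support are not
positive. -/
theorem IsNested.coeff_nonpos_of_sum_eq_zero {α : Finset cs.IrrSpherical}
    (h : cs.IsNested (α : Set cs.IrrSpherical)) (k : {T // T ∈ α} → ℤ) (T : {T // T ∈ α})
    (hT : ∀ T', k T' ≠ 0 → ¬ T < T')
    (hk : letI := standardAbelianCommGroup h
      ∑ T, k T • Additive.ofMul (cs.standardAbelianGen α T) = 0) : k T ≤ 0 := by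
  classical
  let := standardAbelianCommGroup h
  by_contra! hpos
  obtain ⟨i, hiT, hi⟩ := h.exists_mem_forall_lt_notMem α.finite_toSet T.2
  -- Larger sets have coefficient zero, smaller ones miss `i` by its choice, and orthogonal ones are
  -- disjoint from `T`.
  have hne : ∀ T', k T' ≠ 0 → T' ≠ T → i ∉ T'.1.1 := by
    intro T' hT' hTT' hiT'
    rcases h.le_or_le_or_orthogonal α.finite_toSet T.2 T'.2 with hle | hle | horth
    · exact hT T' hT' (lt_of_le_of_ne hle hTT'.symm)
    · exact hi T'.1 T'.2 (lt_of_le_of_ne (b := T.1) hle fun e => hTT' (Subtype.ext e)) hiT'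
    · exact (horth i hiT i hiT').1 rfl
  -- Separating positive and negative parts turns the relation into an equality of positive
  -- elements; only the left side involves `a_i`.
  have hsplit : ∑ T, (k T).toNat • Additive.ofMul (cs.standardAbelianGen α T) =
      ∑ T, (-k T).toNat • Additive.ofMul (cs.standardAbelianGen α T) := by
    rw [← sub_eq_zero, ← Finset.sum_sub_distrib, ← hk]
    refine Finset.sum_congr rfl fun T' _ => ?_
    rw [← natCast_zsmul, ← natCast_zsmul, ← sub_smul, Int.toNat_sub_toNat_neg]
  rw [← Finset.add_sum_erase _ _ (Finset.mem_univ T)] at hsplit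
  have hr := coe_sum_nsmul_standardAbelianGen_mem h (M.artinPositive {i}ᶜ) Finset.univ
    (fun T => (-k T).toNat) fun T' _ hT' => by
      refine M.artinPositive_mono ?_ (cs.artinCentral_mem T'.1)
      rw [Set.subset_compl_singleton_iff]
      refine hne T' (by lia) ?_
      rintro rfl
      lia
  have hp := coe_sum_nsmul_standardAbelianGen_mem h (M.artinPositive Set.univ)
    (Finset.univ.erase T) (fun T => (k T).toNat) fun T' _ _ =>
      M.artinPositive_mono (Set.subset_univ _) (cs.artinCentral_mem T'.1)
  rw [← hsplit] at hr
  exact artinCentral_pow_mul_notMem (X := {i}ᶜ) (T := T.1) hiT (by simp)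
    (n := (k T).toNat) (by lia) hp hr

theorem IsNested.linearIndependent {α : Finset cs.IrrSpherical}
    (h : cs.IsNested (α : Set cs.IrrSpherical)) :
    letI := standardAbelianCommGroup h
    LinearIndependent ℤ fun T : {T // T ∈ α} => Additive.ofMul (cs.standardAbelianGen α T) := by
  let := standardAbelianCommGroup h
  rw [Fintype.linearIndependent_iff]
  intro k hk
  by_contra! hcon
  obtain ⟨T, hT⟩ := (Set.toFinite {T | k T ≠ 0}).exists_maximal hcon
  have hmax : ∀ T', k T' ≠ 0 → ¬ T < T' := fun T' hT' => hT.not_gt hT'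
  have h1 := h.coeff_nonpos_of_sum_eq_zero k T hmax hk
  -- Negating the relation keeps its support, so the coefficient at `T` is also nonnegative.
  have h2 := h.coeff_nonpos_of_sum_eq_zero (-k) T (fun T' hT' => hmax T' (by simpa using hT'))
    (by simp only [Pi.neg_apply, neg_smul, Finset.sum_neg_distrib, hk, neg_zero])
  have h3 := hT.prop
  simp only [Pi.neg_apply] at h2
  exact h3 (by lia)

theorem span_range_standardAbelianGen {α : Finset cs.IrrSpherical}
    (h : cs.IsNested (α : Set cs.IrrSpherical)) :
    letI := standardAbelianCommGroup h
    ⊤ ≤ Submodule.span ℤ (Set.range fun T : {T // T ∈ α} =>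
      Additive.ofMul (cs.standardAbelianGen α T)) := by
  let := standardAbelianCommGroup h
  rintro x -
  obtain ⟨g, hg⟩ := x
  change Additive.ofMul (⟨g, hg⟩ : cs.standardAbelian α) ∈ _
  induction hg using Subgroup.closure_induction with
  | mem x hx =>
    obtain ⟨T, hT, rfl⟩ := hx
    exact Submodule.subset_span ⟨⟨T, hT⟩, rfl⟩
  | one => exact zero_mem _
  | mul x y hx hy ihx ihy => exact add_mem ihx ihy
  | inv x hx ih => exact neg_mem ih

/-- The `δ_T` form a basis of the standard abelian subgroup. -/
noncomputable def standardAbelianBasis {α : Finset cs.IrrSpherical}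
    (h : cs.IsNested (α : Set cs.IrrSpherical)) :
    letI := standardAbelianCommGroup h
    Module.Basis {T // T ∈ α} ℤ (Additive (cs.standardAbelian α)) :=
  letI := standardAbelianCommGroup h
  Module.Basis.mk h.linearIndependent (span_range_standardAbelianGen h)

end CoxeterSystem

theorem lemma2p5 {B W : Type*} [Group W] {M : CoxeterMatrix B} (cs : CoxeterSystem M W)
    (d : ℕ) (α : Finset cs.IrrSpherical) (hα : cs.IsSimplex d α) :
    (∃ φ : ({T // T ∈ α} →₀ ℤ) ≃+ Additive (cs.standardAbelian α),
      ∀ T : {T // T ∈ α},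
        ((φ (Finsupp.single T 1)).toMul : M.ArtinGroup) = cs.artinCentral T.1) ∧
    Nonempty (Additive (cs.standardAbelian α) ≃+ (Fin (d + 1) → ℤ)) := by
  let := CoxeterSystem.standardAbelianCommGroup hα.1
  let b := CoxeterSystem.standardAbelianBasis hα.1
  refine ⟨⟨b.repr.symm.toAddEquiv, fun T => ?_⟩, ⟨?_⟩⟩
  · have e : b.repr.symm (Finsupp.single T 1) =
        Additive.ofMul (cs.standardAbelianGen α T) := by
      rw [Module.Basis.repr_symm_single_one]
      exact Module.Basis.mk_apply _ _ T
    exact congrArg (fun x : Additive (cs.standardAbelian α) => (x.toMul : M.ArtinGroup)) e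
  · exact (b.reindex (α.equivFinOfCardEq hα.2)).equivFun.toAddEquiv
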